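/- Let $G$ be a locally compact (Hausdorff) group. A $G$-algebra is a (not necessarily unital) $C^*$-algebra with an action of $G$ by $*$-automorphisms whose orbit maps are norm continuous; for a $G$-algebra $A$, $C_c(G,A)$ carries the usual convolution $*$-algebra structure. A crossed-product functor $\rtimes_\mu$ assigns to every $G$-algebra $A$ a $C^*$-norm $\|\cdot\|_\mu$ on $C_c(G,A)$ with $\|f\|_r\le\|f\|_\mu\le\|f\|_{\max}$ (the reduced and the maximal crossed-product norm), such that for every equivariant $*$-homomorphism $\phi:A\to B$ the map $f\mapsto\phi\circ f$ extends to a $*$-homomorphism $A\rtimes_\mu G\to B\rtimes_\mu G$ of the completions. It has the ideal property if for every $G$-invariant closed two-sided ideal $I\subseteq A$ the induced map $I\rtimes_\mu G\to A\rtimes_\mu G$ is injective. For an equivariant surjective $*$-homomorphism of $G$-algebras $\pi:C\to A$ with kernel $I$, let $I\rtimes_{\mu,C}G$ be the closure of $C_c(G,I)$ in $C\rtimes_\mu G$. The $\pi$-norm $\|\cdot\|_\pi$ on $C_c(G,A)$ is the norm induced by the inclusion $C_c(G,A)\hookrightarrow (C\rtimes_\mu G)/(I\rtimes_{\mu,C}G)$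 that sends $a$ to the class of any $c\in C_c(G,C)$ with $\pi\circ c=a$. The $\mathcal E(\mu)$-norm is $$\|a\|_{\mathcal E(\mu)}:=\sup\{\|a\|_\pi \mid \pi:C\to A\text{ an equivariant surjection of } G\text{-algebras}\}\qquad(a\in C_c(G,A)).$$ **Proposition.** Let $G$ be a locally compact group, let $\rtimes_\mu$ be a crossed-product functor for $G$, and let $A$ be a $G$-algebra. Then there exist a $G$-algebra $C$ and an equivariant surjection $\pi:C\to A$ such that $\|a\|_{\mathcal E(\mu)}=\|a\|_\pi$ for all $a\in C_c(G,A)$. If moreover $\rtimes_\mu$ has the ideal property and $A$ is unital, then $C$ can be chosen to be unital as well. -/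

import Mathlib

open MeasureTheory Filter Topology Function
open scoped CompactlySupported NNReal ENNReal

universe u

namespace ExoticCrossedProduct

noncomputable section

/-! ## Continuous sections and the modular function -/

/-- A continuous surjective linear map between Banach spaces has a continuous (in general
nonlinear) section that vanishes at the origin. -/
theorem exists_continuous_section {E F : Type*} [NormedAddCommGroup E] [NormedSpace ℂ E]
    [CompleteSpace E] [NormedAddCommGroup F] [NormedSpace ℂ F] [CompleteSpace F]
    (T : E →L[ℂ] F) (hT : Surjective T) :
    ∃ s : C(F, E), s 0 = 0 ∧ ∀ y, T (s y) = y := by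
  obtain ⟨K, hK, hKT⟩ := T.exists_preimage_norm_le hT
  have hr : ∀ n : ℕ, (0 : ℝ) < (1 / 2) ^ n := fun n => by positivity
  have hconvex : ∀ (y : F) (r : ℝ), Convex ℝ {c : E | ‖T c - y‖ < r} := by
    intro y r
    have h := (convex_ball y r).is_linear_preimage
      (f := fun c : E => T c) ((T.restrictScalars ℝ).toLinearMap.isLinear)
    convert h using 1
    ext c
    simp [dist_eq_norm]
  have step : ∀ (n : ℕ) (s : C(F, E)), (∀ y, ‖T (s y) - y‖ < (1 / 2) ^ n) →
      ∃ s' : C(F, E), (∀ y, ‖T (s' y) - y‖ < (1 / 2) ^ (n + 1)) ∧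
        ∀ y, ‖s' y - s y‖ < K * (1 / 2) ^ n := by
    intro n s hs
    obtain ⟨g, hg⟩ := exists_continuous_forall_mem_convex_of_local_const
      (t := fun y => {c : E | ‖T c - y‖ < (1 / 2) ^ (n + 1)} ∩ {c | ‖c - s y‖ < K * (1 / 2) ^ n})
      (fun y => (hconvex y _).inter (by
        have h := convex_ball (s y) (K * (1 / 2) ^ n)
        convert h using 1
        ext c
        simp [dist_eq_norm]))
      (fun y => by
        obtain ⟨d, hd, hdn⟩ := hKT (y - T (s y))
        refine ⟨s y + d, ?_⟩
        have e1 : ‖T (s y + d) - y‖ < (1 / 2) ^ (n + 1) := by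
          have : T (s y + d) - y = 0 := by rw [map_add, hd]; abel
          rw [this, norm_zero]
          exact hr _
        have e2 : ‖s y + d - s y‖ < K * (1 / 2) ^ n := by
          rw [add_sub_cancel_left]
          refine hdn.trans_lt ?_
          rw [norm_sub_rev]
          exact mul_lt_mul_of_pos_left (hs y) hK
        have c1 : Continuous fun z => ‖T (s y + d) - z‖ := by fun_prop
        have c2 : Continuous fun z => ‖s y + d - s z‖ := by fun_prop
        filter_upwards [c1.continuousAt.eventually_lt_const e1,
          c2.continuousAt.eventually_lt_const e2] with z h1 h2
        exact ⟨h1, h2⟩)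
    exact ⟨g, fun y => (hg y).1, fun y => (hg y).2⟩
  have start : ∃ s : C(F, E), ∀ y, ‖T (s y) - y‖ < (1 / 2) ^ 0 := by
    obtain ⟨g, hg⟩ := exists_continuous_forall_mem_convex_of_local_const
      (t := fun y => {c : E | ‖T c - y‖ < (1 / 2) ^ 0}) (fun y => hconvex y _)
      (fun y => by
        obtain ⟨d, hd⟩ := hT y
        refine ⟨d, ?_⟩
        have e1 : ‖T d - y‖ < (1 / 2) ^ 0 := by rw [hd, sub_self, norm_zero]; exact hr 0
        have c1 : Continuous fun z => ‖T d - z‖ := by fun_prop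
        exact c1.continuousAt.eventually_lt_const e1)
    exact ⟨g, hg⟩
  choose! nxt hnxt using step
  obtain ⟨s0, hs0⟩ := start
  let σ : ℕ → C(F, E) := fun n => Nat.rec s0 (fun k s => nxt k s) n
  have hσ : ∀ n y, ‖T (σ n y) - y‖ < (1 / 2) ^ n := by
    intro n
    induction n with
    | zero => exact hs0
    | succ k ih => exact (hnxt k (σ k) ih).1
  have hσ' : ∀ n y, dist (σ n y) (σ (n + 1) y) ≤ K * (1 / 2) ^ n := by
    intro n y
    rw [dist_comm, dist_eq_norm]
    exact ((hnxt n (σ n) (hσ n)).2 y).le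
  have hcauchy : ∀ y, CauchySeq fun n => σ n y := fun y =>
    cauchySeq_of_le_geometric (1 / 2) K (by norm_num) fun n => hσ' n y
  choose L hL using fun y => cauchySeq_tendsto_of_complete (hcauchy y)
  have hunif : TendstoUniformly (fun n y => σ n y) L atTop := by
    rw [Metric.tendstoUniformly_iff]
    intro ε hε
    have h0 : Tendsto (fun n : ℕ => K * (1 / 2 : ℝ) ^ n / (1 - 1 / 2)) atTop (𝓝 0) := by
      have := (tendsto_pow_atTop_nhds_zero_of_lt_one (r := (1 / 2 : ℝ))
        (by norm_num) (by norm_num)).const_mul K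
      simpa using this.div_const (1 - 1 / 2)
    filter_upwards [h0.eventually_lt_const hε] with n hn y
    rw [dist_comm]
    exact (dist_le_of_le_geometric_of_tendsto (1 / 2) K (by norm_num)
      (fun n => hσ' n y) (hL y) n).trans_lt hn
  have hLc : Continuous L := hunif.continuous (Frequently.of_forall fun n => (σ n).continuous)
  have hTL : ∀ y, T (L y) = y := by
    intro y
    have h1 : Tendsto (fun n => ‖T (σ n y) - y‖) atTop (𝓝 ‖T (L y) - y‖) :=
      (((T.continuous.tendsto _).comp (hL y)).sub_const y).norm
    have h2 : Tendsto (fun n => ‖T (σ n y) - y‖) atTop (𝓝 0) :=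
      squeeze_zero (fun _ => norm_nonneg _) (fun n => (hσ n y).le)
        (tendsto_pow_atTop_nhds_zero_of_lt_one (by norm_num) (by norm_num))
    exact sub_eq_zero.mp (norm_eq_zero.mp (tendsto_nhds_unique h1 h2))
  refine ⟨⟨fun y => L y - L 0, by fun_prop⟩, by simp, fun y => ?_⟩
  simp [map_sub, hTL]

theorem continuous_modularCharacterFun {G : Type u} [Group G] [TopologicalSpace G]
    [IsTopologicalGroup G] [LocallyCompactSpace G] :
    Continuous (Measure.modularCharacterFun : G → ℝ≥0) := by
  borelize G
  let ν := Measure.haar (G := G)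
  obtain ⟨⟨f, f_cont⟩, f_comp, f_nonneg, f_one⟩ :
    ∃ f : C(G, ℝ), HasCompactSupport f ∧ 0 ≤ f ∧ f 1 ≠ 0 := exists_continuous_nonneg_pos 1
  have hne : ∫ x, f x ∂ν ≠ 0 :=
    ne_of_gt (f_cont.integral_pos_of_hasCompactSupport_nonneg_nonzero f_comp f_nonneg f_one)
  have key : ∀ g : G, (Measure.modularCharacterFun g : ℝ) =
      (∫ x, f (x * g) ∂ν) / ∫ x, f x ∂ν := by
    intro g
    have h1 := Measure.haarScalarFactor_eq_integral_div (Measure.map (· * g) ν) ν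
      f_cont f_comp hne
    rw [integral_map (AEMeasurable.mul_const aemeasurable_id' _)
      (Continuous.aestronglyMeasurable f_cont)] at h1
    rw [Measure.modularCharacterFun_eq_haarScalarFactor ν g]
    exact h1
  have hcont : Continuous fun g : G => ∫ x, f (x * g) ∂ν := by
    refine continuous_iff_continuousAt.2 fun g₀ => ?_
    obtain ⟨t, t_comp, ht⟩ : ∃ t, IsCompact t ∧ t ∈ 𝓝 g₀ := exists_compact_mem_nhds g₀
    have A : ContinuousOn (fun g : G => ∫ x, f (x * g) ∂ν) t := by
      refine continuousOn_integral_of_compact_support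
        (IsCompact.mul (show IsCompact (tsupport f) from f_comp) t_comp.inv)
        (by fun_prop) fun g x hg hx => ?_
      by_contra h
      exact hx ⟨x * g, subset_tsupport _ h, g⁻¹, by simpa using hg, by simp⟩
    exact A.continuousAt ht
  refine NNReal.isEmbedding_coe.continuous_iff.2 ?_
  have : (fun g : G => (Measure.modularCharacterFun g : ℝ)) =
      fun g => (∫ x, f (x * g) ∂ν) / ∫ x, f x ∂ν := funext key
  change Continuous fun g : G => (Measure.modularCharacterFun g : ℝ)
  rw [this]
  exact hcont.div_const _

/-! ## G-algebras -/

/-- A `G`-algebra: a (not necessarily unital) C⋆-algebra with an action of `G` by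
⋆-automorphisms such that every orbit map `g ↦ g • a` is norm continuous. (Each `act g` is
invertible with inverse `act g⁻¹`.) -/
structure GAlgebra (G : Type u) [Group G] [TopologicalSpace G] where
  carrier : Type u
  [cstar : NonUnitalCStarAlgebra carrier]
  act : G → carrier →⋆ₙₐ[ℂ] carrier
  act_one : ∀ a, act 1 a = a
  act_mul : ∀ g h a, act (g * h) a = act g (act h a)
  continuous_act : ∀ a, Continuous fun g => act g a

section Group

variable {G : Type u} [Group G] [TopologicalSpace G]

instance : CoeSort (GAlgebra G) (Type u) := ⟨GAlgebra.carrier⟩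

instance (A : GAlgebra G) : NonUnitalCStarAlgebra A := A.cstar

/-- A `G`-algebra is unital if its underlying C⋆-algebra has a unit. -/
def GAlgebra.IsUnital (A : GAlgebra G) : Prop := ∃ e : A, ∀ a : A, e * a = a ∧ a * e = a

/-- Equivariant ⋆-homomorphisms. -/
structure GHom (A B : GAlgebra G) where
  toHom : A →⋆ₙₐ[ℂ] B
  map_act : ∀ g a, toHom (A.act g a) = B.act g (toHom a)

instance (A B : GAlgebra G) : CoeFun (GHom A B) (fun _ => A → B) := ⟨fun φ => φ.toHom⟩

theorem GHom.continuous {A B : GAlgebra G} (φ : GHom A B) : Continuous φ :=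
  AddMonoidHomClass.continuous_of_bound φ.toHom 1 fun a => by
    simpa using NonUnitalStarAlgHom.norm_apply_le φ.toHom a

/-- An equivariant ⋆-homomorphism as a continuous linear map. -/
def GHom.toCLM {A B : GAlgebra G} (φ : GHom A B) : A →L[ℂ] B where
  toFun := φ
  map_add' := map_add φ.toHom
  map_smul' := map_smul φ.toHom
  cont := φ.continuous

theorem GAlgebra.continuous_act_uncurry (A : GAlgebra G) :
    Continuous fun p : G × A => A.act p.1 p.2 := by
  refine continuous_iff_continuousAt.2 fun ⟨g₀, a₀⟩ => ?_
  rw [ContinuousAt, tendsto_iff_norm_sub_tendsto_zero]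
  have h1 : Tendsto (fun p : G × A => ‖p.2 - a₀‖ + ‖A.act p.1 a₀ - A.act g₀ a₀‖)
      (𝓝 (g₀, a₀)) (𝓝 0) := by
    have hc : Continuous fun p : G × A => ‖p.2 - a₀‖ + ‖A.act p.1 a₀ - A.act g₀ a₀‖ :=
      (continuous_snd.sub continuous_const).norm.add
        ((((A.continuous_act a₀).comp continuous_fst).sub continuous_const).norm)
    simpa using hc.tendsto (g₀, a₀)
  refine squeeze_zero (fun _ => norm_nonneg _) (fun p => ?_) h1
  have : A.act p.1 p.2 - A.act g₀ a₀ =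
      A.act p.1 (p.2 - a₀) + (A.act p.1 a₀ - A.act g₀ a₀) := by
    rw [map_sub]; abel
  rw [this]
  exact (norm_add_le _ _).trans
    (add_le_add (NonUnitalStarAlgHom.norm_apply_le (A.act p.1) _) le_rfl)

/-- The algebraic descent `C_c(G, A) → C_c(G, B)`, `f ↦ φ ∘ f`. -/
def mapCc {A B : GAlgebra G} (φ : GHom A B) : C_c(G, A) →ₗ[ℂ] C_c(G, B) where
  toFun f :=
    { toFun := fun x => φ (f x)
      continuous_toFun := φ.continuous.comp f.continuous
      hasCompactSupport' := f.hasCompactSupport.comp_left (map_zero φ.toHom) }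
  map_add' f g := by ext x; exact map_add φ.toHom _ _
  map_smul' c f := by ext x; exact map_smul φ.toHom _ _

/-- Every compactly supported continuous function lifts along an equivariant surjection. -/
theorem mapCc_surjective {C A : GAlgebra G} (π : GHom C A) (hπ : Surjective π) :
    Surjective (mapCc π) := by
  obtain ⟨s, hs0, hs⟩ := exists_continuous_section π.toCLM hπ
  intro f
  refine ⟨⟨⟨fun x => s (f x), s.continuous.comp f.continuous⟩,
    f.hasCompactSupport.comp_left hs0⟩, ?_⟩
  ext x
  exact hs (f x)

/-- A covariant representation of a `G`-algebra on a Hilbert space. -/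
structure CovariantRep (A : GAlgebra G) (H : Type u) [NormedAddCommGroup H]
    [InnerProductSpace ℂ H] [CompleteSpace H] where
  ρ : A →⋆ₙₐ[ℂ] (H →L[ℂ] H)
  U : G →* unitary (H →L[ℂ] H)
  continuous_U : ∀ ξ : H, Continuous fun g => (U g : H →L[ℂ] H) ξ
  covariant : ∀ (g : G) (a : A),
    ρ (A.act g a) = (U g : H →L[ℂ] H) * ρ a * star (U g : H →L[ℂ] H)

theorem CovariantRep.norm_apply_le {A : GAlgebra G} {H : Type u} [NormedAddCommGroup H]
    [InnerProductSpace ℂ H] [CompleteSpace H] (R : CovariantRep A H) (f : C_c(G, A)) (ξ : H)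
    (x : G) : ‖R.ρ (f x) ((R.U x : H →L[ℂ] H) ξ)‖ ≤ ‖f x‖ * ‖ξ‖ := by
  refine (ContinuousLinearMap.le_opNorm _ _).trans ?_
  rw [ContinuousLinearMap.norm_map_of_mem_unitary (R.U x).2]
  exact mul_le_mul_of_nonneg_right (NonUnitalStarAlgHom.norm_apply_le R.ρ (f x)) (norm_nonneg _)

end Group

/-! ## The convolution ⋆-algebra `C_c(G, A)` -/

section Convolution

variable {G : Type u} [Group G] [TopologicalSpace G] [IsTopologicalGroup G]
  [LocallyCompactSpace G]

/-- The involution `f⋆(x) = Δ(x⁻¹) α_x(f(x⁻¹)⋆)`. Mathlib's `modularCharacterFun` is normalised by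
`μ (E x⁻¹) = modularCharacterFun x * μ E` for left Haar measure `μ`, so that
`modularCharacterFun x` is the factor `Δ(x⁻¹)` in the convention `μ (E x) = Δ(x) * μ E`. -/
def invol (A : GAlgebra G) (f : C_c(G, A)) : C_c(G, A) where
  toFun x := ((Measure.modularCharacterFun x : ℝ) : ℂ) • A.act x (star (f x⁻¹))
  continuous_toFun := by
    have h1 : Continuous fun x : G => ((Measure.modularCharacterFun x : ℝ) : ℂ) :=
      Complex.continuous_ofReal.comp
        (NNReal.continuous_coe.comp continuous_modularCharacterFun)
    have h2 : Continuous fun x : G => A.act x (star (f x⁻¹)) :=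
      A.continuous_act_uncurry.comp
        (continuous_id.prodMk (f.continuous.comp continuous_inv).star)
    exact h1.smul h2
  hasCompactSupport' := by
    refine HasCompactSupport.intro
      (IsCompact.inv (show IsCompact (tsupport f) from f.hasCompactSupport)) fun x hx => ?_
    have : f x⁻¹ = 0 := image_eq_zero_of_notMem_tsupport fun h => hx (by simpa using h)
    simp [this]

variable [MeasurableSpace G] [BorelSpace G]

/-- `x ↦ ∫ k(x, y) dy` for a continuous kernel `k` that vanishes unless `y` and `y⁻¹ x` lie in the
supports of `f` and `g`. -/
def ofKernel {A : GAlgebra G} (f g : C_c(G, A)) (k : G → G → A) (hk : Continuous k.uncurry)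
    (hf : ∀ x y, f y = 0 → k x y = 0) (hg : ∀ x y, g (y⁻¹ * x) = 0 → k x y = 0) : C_c(G, A) where
  toFun x := ∫ y, k x y ∂Measure.haar
  continuous_toFun := by
    rw [← continuousOn_univ]
    exact continuousOn_integral_of_compact_support
      (show IsCompact (tsupport f) from f.hasCompactSupport) hk.continuousOn
      fun x y _ hy => hf x y (image_eq_zero_of_notMem_tsupport hy)
  hasCompactSupport' := by
    refine HasCompactSupport.intro
      (IsCompact.mul (show IsCompact (tsupport f) from f.hasCompactSupport)
        (show IsCompact (tsupport g) from g.hasCompactSupport)) fun x hx => ?_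
    have : ∀ y, k x y = 0 := by
      intro y
      by_cases hy : f y = 0
      · exact hf x y hy
      · refine hg x y (image_eq_zero_of_notMem_tsupport fun h => hx ?_)
        exact ⟨y, subset_tsupport _ hy, y⁻¹ * x, h, by simp⟩
    simp [this]

/-- The convolution product `(f * g)(x) = ∫ f(y) α_y(g(y⁻¹ x)) dy` for left Haar measure. -/
def conv (A : GAlgebra G) (f g : C_c(G, A)) : C_c(G, A) :=
  ofKernel f g (fun x y => f y * A.act y (g (y⁻¹ * x)))
    ((f.continuous.comp continuous_snd).mul
      (A.continuous_act_uncurry.comp (continuous_snd.prodMk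
        (g.continuous.comp (continuous_snd.inv.mul continuous_fst)))))
    (fun x y h => by simp [h]) (fun x y h => by simp [h])

/-! ## The reduced norm -/

/-- The regular representation of `f` on `ξ ∈ C_c(G, A) ⊆ L²(G, A)`:
`(Λ(f) ξ)(x) = ∫ α_{x⁻¹}(f(y)) ξ(y⁻¹ x) dy`. -/
def regRep (A : GAlgebra G) (f ξ : C_c(G, A)) : C_c(G, A) :=
  ofKernel f ξ (fun x y => A.act x⁻¹ (f y) * ξ (y⁻¹ * x))
    ((A.continuous_act_uncurry.comp
        (continuous_fst.inv.prodMk (f.continuous.comp continuous_snd))).mul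
      (ξ.continuous.comp (continuous_snd.inv.mul continuous_fst)))
    (fun x y h => by simp [h]) (fun x y h => by simp [h])

/-- The norm of the Hilbert `A`-module `L²(G, A)` on its dense submodule `C_c(G, A)`:
`‖ξ‖ = ‖∫ ξ(x)⋆ ξ(x) dx‖^{1/2}`. -/
def l2Norm (A : GAlgebra G) (ξ : C_c(G, A)) : ℝ :=
  Real.sqrt ‖∫ x, star (ξ x) * ξ x ∂Measure.haar‖

/-- The reduced norm of `f`: the operator norm of `Λ(f)` on the Hilbert module `L²(G, A)`. -/
def reducedNorm (A : GAlgebra G) (f : C_c(G, A)) : ℝ≥0∞ :=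
  ⨆ (ξ : C_c(G, A)) (_ : l2Norm A ξ ≤ 1), ENNReal.ofReal (l2Norm A (regRep A f ξ))

/-! ## The maximal norm -/

section CovariantRep

variable {A : GAlgebra G} {H : Type u} [NormedAddCommGroup H] [InnerProductSpace ℂ H]
  [CompleteSpace H]

theorem CovariantRep.integrable (R : CovariantRep A H) (f : C_c(G, A)) (ξ : H) :
    Integrable (fun x => R.ρ (f x) ((R.U x : H →L[ℂ] H) ξ)) Measure.haar := by
  refine Continuous.integrable_of_hasCompactSupport ?_ ?_
  · have hρ : Continuous R.ρ := AddMonoidHomClass.continuous_of_bound R.ρ 1 fun a => by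
      simpa using NonUnitalStarAlgHom.norm_apply_le R.ρ a
    exact (hρ.comp f.continuous).clm_apply (R.continuous_U ξ)
  · refine HasCompactSupport.intro f.hasCompactSupport fun x hx => ?_
    have : f x = 0 := image_eq_zero_of_notMem_tsupport hx
    simp [this]

/-- The integrated form `(ρ ⋊ U)(f) ξ = ∫ ρ(f(x)) U_x ξ dx`. -/
def CovariantRep.integrated (R : CovariantRep A H) (f : C_c(G, A)) : H →L[ℂ] H :=
  LinearMap.mkContinuous
    { toFun := fun ξ => ∫ x, R.ρ (f x) ((R.U x : H →L[ℂ] H) ξ) ∂Measure.haar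
      map_add' := fun ξ η => by
        simp only [map_add]
        exact integral_add (R.integrable f ξ) (R.integrable f η)
      map_smul' := fun c ξ => by
        simp only [map_smul, RingHom.id_apply]
        exact integral_smul c _ }
    (∫ x, ‖f x‖ ∂Measure.haar)
    (fun ξ => by
      have hf : Integrable (fun x => ‖f x‖) (Measure.haar : Measure G) :=
        (f.continuous.integrable_of_hasCompactSupport f.hasCompactSupport).norm
      rw [← integral_mul_const]
      exact (norm_integral_le_integral_norm _).trans
        (integral_mono (R.integrable f ξ).norm (hf.mul_const _)
          fun x => R.norm_apply_le f ξ x))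

end CovariantRep

/-- The maximal norm: the supremum of the norms of `f` in all covariant representations. -/
def maxNorm (A : GAlgebra G) (f : C_c(G, A)) : ℝ≥0∞ :=
  ⨆ (H : Type u) (_ : NormedAddCommGroup H) (_ : InnerProductSpace ℂ H) (_ : CompleteSpace H)
    (R : CovariantRep A H), ‖R.integrated f‖ₑ

/-! ## Crossed-product functors -/

variable (G) in
/-- A crossed-product functor for `G`: for every `G`-algebra `A` a C⋆-norm on the convolution
⋆-algebra `C_c(G, A)` between the reduced and the maximal norm, such that for every equivariant
⋆-homomorphism `φ : A → B` the map `f ↦ φ ∘ f` extends to the completions. (The extension is a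
⋆-homomorphism of C⋆-algebras, hence contractive, and conversely a contractive map extends.
Definiteness of the norm follows from `reduced_le`.) -/
structure CrossedProductFunctor where
  seminorm : ∀ A : GAlgebra G, Seminorm ℂ C_c(G, A)
  conv_le : ∀ (A : GAlgebra G) (f g : C_c(G, A)),
    seminorm A (conv A f g) ≤ seminorm A f * seminorm A g
  cstar : ∀ (A : GAlgebra G) (f : C_c(G, A)),
    seminorm A (conv A (invol A f) f) = seminorm A f ^ 2
  reduced_le : ∀ (A : GAlgebra G) (f : C_c(G, A)),
    reducedNorm A f ≤ ENNReal.ofReal (seminorm A f)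
  le_max : ∀ (A : GAlgebra G) (f : C_c(G, A)),
    ENNReal.ofReal (seminorm A f) ≤ maxNorm A f
  map_le : ∀ (A B : GAlgebra G) (φ : GHom A B) (f : C_c(G, A)),
    seminorm B (mapCc φ f) ≤ seminorm A f

namespace CrossedProductFunctor

variable (μ : CrossedProductFunctor G)

/-- `C_c(G, A)` equipped with the `μ`-norm. -/
def Alg (_μ : CrossedProductFunctor G) (A : GAlgebra G) : Type u := C_c(G, A)

instance (A : GAlgebra G) : AddCommGroup (μ.Alg A) := inferInstanceAs (AddCommGroup C_c(G, A))

instance (A : GAlgebra G) : Module ℂ (μ.Alg A) := inferInstanceAs (Module ℂ C_c(G, A))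

/-- The identity map from `C_c(G, A)` to its copy with the `μ`-norm. -/
def toAlg (A : GAlgebra G) : C_c(G, A) ≃ₗ[ℂ] μ.Alg A := LinearEquiv.refl ℂ _

instance (A : GAlgebra G) : SeminormedAddCommGroup (μ.Alg A) :=
  AddGroupSeminorm.toSeminormedAddCommGroup
    (show AddGroupSeminorm (μ.Alg A) from (μ.seminorm A).toAddGroupSeminorm)

theorem norm_toAlg (A : GAlgebra G) (f : C_c(G, A)) : ‖μ.toAlg A f‖ = μ.seminorm A f := rfl

instance (A : GAlgebra G) : NormedSpace ℂ (μ.Alg A) where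
  norm_smul_le c f := le_of_eq (map_smul_eq_mul (μ.seminorm A) c f)

/-- The crossed product `A ⋊_μ G` (as a Banach space): the completion of `C_c(G, A)` in the
`μ`-norm. -/
abbrev Crossed (A : GAlgebra G) : Type u := UniformSpace.Completion (μ.Alg A)

/-- The canonical map `C_c(G, A) → A ⋊_μ G`. -/
def toCrossed (A : GAlgebra G) : C_c(G, A) →ₗ[ℂ] μ.Crossed A :=
  (UniformSpace.Completion.toComplₗᵢ (𝕜 := ℂ) (E := μ.Alg A)).toLinearMap ∘ₗ
    (μ.toAlg A).toLinearMap

theorem norm_toCrossed (A : GAlgebra G) (f : C_c(G, A)) :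
    ‖μ.toCrossed A f‖ = μ.seminorm A f :=
  UniformSpace.Completion.norm_coe (μ.toAlg A f)

/-- The descent of an equivariant ⋆-homomorphism to the algebraic crossed products. -/
def descentAlg {A B : GAlgebra G} (φ : GHom A B) : μ.Alg A →L[ℂ] μ.Alg B :=
  LinearMap.mkContinuous
    ((μ.toAlg B).toLinearMap ∘ₗ mapCc φ ∘ₗ (μ.toAlg A).symm.toLinearMap) 1
    (fun f => by
      rw [one_mul]
      exact μ.map_le A B φ ((μ.toAlg A).symm f))

/-- The induced map `φ ⋊_μ G : A ⋊_μ G → B ⋊_μ G`. -/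
def descent {A B : GAlgebra G} (φ : GHom A B) : μ.Crossed A →L[ℂ] μ.Crossed B :=
  (μ.descentAlg φ).completion

theorem descent_toCrossed {A B : GAlgebra G} (φ : GHom A B) (f : C_c(G, A)) :
    μ.descent φ (μ.toCrossed A f) = μ.toCrossed B (mapCc φ f) :=
  UniformSpace.Completion.map_coe (μ.descentAlg φ).uniformContinuous _

/-- The ideal property: for every equivariant inclusion `ι : I → A` of an ideal, the induced map
`I ⋊_μ G → A ⋊_μ G` is injective. -/
def IdealProperty : Prop :=
  ∀ (I A : GAlgebra G) (ι : GHom I A), Injective ι →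
    (∀ (x : I) (a : A), (∃ y, ι y = a * ι x) ∧ (∃ y, ι y = ι x * a)) →
    Injective (μ.descent ι)

/-- For `π : C → A` with kernel `I`, the closed subspace `I ⋊_{μ,C} G` of `C ⋊_μ G`: the closure
of `C_c(G, I)`. -/
def kernelCrossed {C A : GAlgebra G} (π : GHom C A) : Submodule ℂ (μ.Crossed C) :=
  ((LinearMap.ker (mapCc π)).map (μ.toCrossed C)).topologicalClosure

instance {C A : GAlgebra G} (π : GHom C A) :
    IsClosed (μ.kernelCrossed π : Set (μ.Crossed C)) :=
  Submodule.isClosed_topologicalClosure _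

/-- The dense inclusion `C_c(G, A) → (C ⋊_μ G) / (I ⋊_{μ,C} G)` given by an equivariant surjection
`π : C → A` with kernel `I`: it sends `a` to the class of any lift of `a` to `C_c(G, C)`. -/
def quotientInclusion {C A : GAlgebra G} (π : GHom C A) (hπ : Surjective π) (a : C_c(G, A)) :
    μ.Crossed C ⧸ μ.kernelCrossed π :=
  (μ.kernelCrossed π).mkQ (μ.toCrossed C (surjInv (mapCc_surjective π hπ) a))

/-- The inclusion does not depend on the chosen lift. -/
theorem quotientInclusion_mapCc {C A : GAlgebra G} (π : GHom C A) (hπ : Surjective π)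
    (c : C_c(G, C)) :
    μ.quotientInclusion π hπ (mapCc π c) = (μ.kernelCrossed π).mkQ (μ.toCrossed C c) := by
  refine (Submodule.Quotient.eq _).2 ?_
  rw [← map_sub]
  refine Submodule.le_topologicalClosure _ (Submodule.mem_map_of_mem ?_)
  rw [LinearMap.mem_ker, map_sub, surjInv_eq (mapCc_surjective π hπ), sub_self]

/-- The `π`-norm on `C_c(G, A)`: the norm induced from the quotient
`(C ⋊_μ G) / (I ⋊_{μ,C} G)`. -/
def piNorm {C A : GAlgebra G} (π : GHom C A) (hπ : Surjective π) (a : C_c(G, A)) : ℝ :=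
  ‖μ.quotientInclusion π hπ a‖

/-- The `𝓔(μ)`-norm on `C_c(G, A)`: the supremum of the `π`-norms over all equivariant surjections
`π : C → A`, taken in `[0, ∞]`. -/
def exactNorm (A : GAlgebra G) (a : C_c(G, A)) : ℝ≥0∞ :=
  ⨆ (C : GAlgebra G) (π : GHom C A) (hπ : Surjective π), ENNReal.ofReal (μ.piNorm π hπ a)

end CrossedProductFunctor

end Convolution

end

end ExoticCrossedProduct

/-! For the first claim, a single surjection has to dominate all others. The surjections onto `A`
form a proper class, but for each `a ∈ C_c(G, A)` and each `r` below `‖a‖_{𝓔(μ)}` one surjection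
with `r < ‖a‖_π` suffices, so a family indexed by a set is enough. Its fibre product over `A`
(bounded families with a common image in `A` and a norm continuous orbit) maps to `A` through every
member of the family, and the `π`-norm can only grow along such a factorization
(`piNorm_le_of_factor`).

The difficulty is surjectivity of the fibre product (`fibreProduct_surjective`). Coordinatewise
lifts of `a` can be bounded uniformly, but their joint orbit need not be continuous. Averaging them
against a bump function `φ` near `1` repairs this with a modulus of continuity independent of the
coordinate, and replaces `a` by `∫ φ(g) α_g(a) dg`, which is close to `a`. Successive approximation
then yields exact preimages.

For the second claim, `C` is replaced by its unitization. This enlarges the kernel of the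
surjection, so the quotient norm might drop. The ideal property makes `C ⋊_μ G` an isometrically
embedded ideal of the larger crossed product, and an approximate unit of `C ⋊_μ G` pushes elements
of the larger kernel into the smaller one (`piNorm_le_of_ideal`). These arguments use the
C⋆-structure of the crossed products, which is built beforehand. -/

set_option linter.unusedSectionVars false

namespace ExoticCrossedProduct

noncomputable section

/-! ## Algebra of the convolution product -/

section ConvolutionAlgebra

variable {G : Type u} [Group G] [TopologicalSpace G]

theorem mapCc_apply {A B : GAlgebra G} (φ : GHom A B) (f : C_c(G, A)) (x : G) :
    mapCc φ f x = φ (f x) := rfl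

/-- The action of a group element as a continuous linear map. -/
def GAlgebra.actCLM (A : GAlgebra G) (g : G) : A →L[ℂ] A where
  toFun := A.act g
  map_add' := map_add _
  map_smul' := map_smul _
  cont := A.continuous_act_uncurry.comp (continuous_const.prodMk continuous_id)

theorem GAlgebra.actCLM_apply (A : GAlgebra G) (g : G) (a : A) : A.actCLM g a = A.act g a := rfl

theorem GAlgebra.norm_act (A : GAlgebra G) (g : G) (a : A) : ‖A.act g a‖ = ‖a‖ := by
  refine le_antisymm (NonUnitalStarAlgHom.norm_apply_le (A.act g) a) ?_
  calc ‖a‖ = ‖A.act g⁻¹ (A.act g a)‖ := by rw [← A.act_mul, inv_mul_cancel, A.act_one]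
    _ ≤ _ := NonUnitalStarAlgHom.norm_apply_le (A.act g⁻¹) _

variable [IsTopologicalGroup G] [LocallyCompactSpace G]

theorem invol_apply (A : GAlgebra G) (f : C_c(G, A)) (x : G) :
    invol A f x = ((Measure.modularCharacterFun x : ℝ) : ℂ) • A.act x (star (f x⁻¹)) := rfl

theorem invol_add (A : GAlgebra G) (f g : C_c(G, A)) :
    invol A (f + g) = invol A f + invol A g := by
  ext x
  simp [invol_apply]

theorem invol_smul (A : GAlgebra G) (c : ℂ) (f : C_c(G, A)) :
    invol A (c • f) = star c • invol A f := by
  ext x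
  simp only [invol_apply, CompactlySupportedContinuousMap.smul_apply, star_smul, map_smul]
  exact smul_comm _ _ _

theorem invol_invol (A : GAlgebra G) (f : C_c(G, A)) : invol A (invol A f) = f := by
  ext x
  have hne : (Measure.modularCharacterFun x : ℝ) * Measure.modularCharacterFun x⁻¹ = 1 := by
    rw [← NNReal.coe_mul, ← Measure.modularCharacterFun_map_mul, mul_inv_cancel,
      Measure.modularCharacterFun_map_one, NNReal.coe_one]
  simp only [invol_apply, inv_inv, star_smul, map_smul, smul_smul, ← map_star, star_star,
    ← A.act_mul, mul_inv_cancel, A.act_one]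
  rw [Complex.star_def, Complex.conj_ofReal, ← Complex.ofReal_mul, hne, Complex.ofReal_one,
    one_smul]

theorem mapCc_invol {A B : GAlgebra G} (φ : GHom A B) (f : C_c(G, A)) :
    mapCc φ (invol A f) = invol B (mapCc φ f) := by
  ext x
  rw [mapCc_apply, invol_apply, invol_apply, map_smul, φ.map_act, map_star]
  rfl

variable [MeasurableSpace G] [BorelSpace G]

theorem conv_apply (A : GAlgebra G) (f g : C_c(G, A)) (x : G) :
    conv A f g x = ∫ y, f y * A.act y (g (y⁻¹ * x)) ∂Measure.haar := rfl

theorem integrable_conv (A : GAlgebra G) (f g : C_c(G, A)) (x : G) :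
    Integrable (fun y => f y * A.act y (g (y⁻¹ * x))) Measure.haar := by
  refine Continuous.integrable_of_hasCompactSupport ?_ ?_
  · exact f.continuous.mul (A.continuous_act_uncurry.comp
      (continuous_id.prodMk (g.continuous.comp (continuous_id.inv.mul continuous_const))))
  · exact f.hasCompactSupport.mul_right

theorem conv_add_left (A : GAlgebra G) (f f' g : C_c(G, A)) :
    conv A (f + f') g = conv A f g + conv A f' g := by
  ext x
  simp only [conv_apply, CompactlySupportedContinuousMap.add_apply, add_mul]
  exact integral_add (integrable_conv A f g x) (integrable_conv A f' g x)

theorem conv_add_right (A : GAlgebra G) (f g g' : C_c(G, A)) :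
    conv A f (g + g') = conv A f g + conv A f g' := by
  ext x
  simp only [conv_apply, CompactlySupportedContinuousMap.add_apply, map_add, mul_add]
  exact integral_add (integrable_conv A f g x) (integrable_conv A f g' x)

theorem conv_smul_left (A : GAlgebra G) (c : ℂ) (f g : C_c(G, A)) :
    conv A (c • f) g = c • conv A f g := by
  ext x
  simp only [conv_apply, CompactlySupportedContinuousMap.smul_apply, smul_mul_assoc]
  exact integral_smul c _

theorem conv_smul_right (A : GAlgebra G) (c : ℂ) (f g : C_c(G, A)) :
    conv A f (c • g) = c • conv A f g := by
  ext x
  simp only [conv_apply, CompactlySupportedContinuousMap.smul_apply, map_smul, mul_smul_comm]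
  exact integral_smul c _

theorem conv_zero_left (A : GAlgebra G) (f : C_c(G, A)) : conv A 0 f = 0 := by
  simpa using conv_smul_left A 0 0 f

theorem conv_zero_right (A : GAlgebra G) (f : C_c(G, A)) : conv A f 0 = 0 := by
  simpa using conv_smul_right A 0 f 0

theorem conv_assoc (A : GAlgebra G) (f g h : C_c(G, A)) :
    conv A (conv A f g) h = conv A f (conv A g h) := by
  ext x
  have hcont : Continuous (uncurry fun y z =>
      f z * A.act z (g (z⁻¹ * y)) * A.act y (h (y⁻¹ * x))) := by
    refine ((f.continuous.comp continuous_snd).mul (A.continuous_act_uncurry.comp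
      (continuous_snd.prodMk (g.continuous.comp (continuous_snd.inv.mul continuous_fst))))).mul ?_
    exact A.continuous_act_uncurry.comp
      (continuous_fst.prodMk (h.continuous.comp (continuous_fst.inv.mul continuous_const)))
  -- Compact support of the double integrand allows the order of integration to be exchanged without
  -- σ-finiteness of Haar measure.
  have hsupp : HasCompactSupport (uncurry fun y z =>
      f z * A.act z (g (z⁻¹ * y)) * A.act y (h (y⁻¹ * x))) := by
    have hf : IsCompact (tsupport f) := f.hasCompactSupport
    have hg : IsCompact (tsupport g) := g.hasCompactSupport
    refine HasCompactSupport.intro ((hf.mul hg).prod hf) ?_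
    rintro ⟨y, z⟩ hyz
    simp only [uncurry_apply_pair]
    by_cases hz : z ∈ tsupport f
    · have : z⁻¹ * y ∉ tsupport g := fun hy => hyz ⟨⟨z, hz, z⁻¹ * y, hy, by simp⟩, hz⟩
      simp [image_eq_zero_of_notMem_tsupport this]
    · simp [image_eq_zero_of_notMem_tsupport hz]
  calc conv A (conv A f g) h x
      = ∫ y, ∫ z, f z * A.act z (g (z⁻¹ * y)) * A.act y (h (y⁻¹ * x))
          ∂Measure.haar ∂Measure.haar := by
        rw [conv_apply]
        refine integral_congr_ae (.of_forall fun y => ?_)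
        exact (integral_mul_const_of_integrable (integrable_conv A f g y)).symm
    _ = ∫ z, ∫ y, f z * A.act z (g (z⁻¹ * y)) * A.act y (h (y⁻¹ * x))
          ∂Measure.haar ∂Measure.haar := integral_integral_swap_of_hasCompactSupport hcont hsupp
    _ = conv A f (conv A g h) x := by
        rw [conv_apply]
        refine integral_congr_ae (.of_forall fun z => ?_)
        dsimp only
        -- Left invariance: substitute `y = z * w`.
        rw [← integral_mul_left_eq_self _ z, conv_apply, ← A.actCLM_apply,
          ← ContinuousLinearMap.integral_comp_comm _ (integrable_conv A g h _),
          ← integral_const_mul_of_integrable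
            ((A.actCLM z).integrable_comp (integrable_conv A g h _))]
        refine integral_congr_ae (.of_forall fun w => ?_)
        simp only [A.actCLM_apply, map_mul, ← A.act_mul, mul_assoc, inv_mul_cancel_left,
          mul_inv_rev]

theorem invol_conv (A : GAlgebra G) (f g : C_c(G, A)) :
    invol A (conv A f g) = conv A (invol A g) (invol A f) := by
  ext x
  -- After the substitution `y ↦ x * y`, the modular factors of the two involutions combine to the
  -- one at `x`, so left invariance alone suffices.
  have key : ∀ y, Measure.modularCharacterFun ((x * y)⁻¹ * x) *
      Measure.modularCharacterFun (x * y) = Measure.modularCharacterFun x := fun y => by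
    rw [mul_comm, ← Measure.modularCharacterFun_map_mul, mul_inv_cancel_left]
  rw [invol_apply, conv_apply, conv_apply A (invol A g), ← integral_mul_left_eq_self
    (fun y => invol A g y * A.act y (invol A f (y⁻¹ * x))) x]
  have hstar : star (∫ y, f y * A.act y (g (y⁻¹ * x⁻¹)) ∂Measure.haar) =
      ∫ y, star (f y * A.act y (g (y⁻¹ * x⁻¹))) ∂Measure.haar :=
    ((starL' ℝ (A := A)).toContinuousLinearMap.integral_comp_comm
      (integrable_conv A f g x⁻¹)).symm
  have hint : Integrable (fun y => star (f y * A.act y (g (y⁻¹ * x⁻¹)))) Measure.haar :=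
    (starL' ℝ (A := A)).toContinuousLinearMap.integrable_comp (integrable_conv A f g x⁻¹)
  rw [hstar, ← A.actCLM_apply, ← ContinuousLinearMap.integral_comp_comm _ hint, ← integral_smul]
  refine integral_congr_ae (.of_forall fun y => ?_)
  simp only [A.actCLM_apply, invol_apply, star_mul, map_mul, map_smul, ← A.act_mul, map_star,
    smul_mul_assoc, mul_smul_comm, smul_smul, ← Complex.ofReal_mul, ← NNReal.coe_mul, key]
  simp [mul_assoc]

theorem mapCc_conv {A B : GAlgebra G} (φ : GHom A B) (f g : C_c(G, A)) :
    mapCc φ (conv A f g) = conv B (mapCc φ f) (mapCc φ g) := by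
  ext x
  rw [mapCc_apply, conv_apply, conv_apply]
  refine (φ.toCLM.integral_comp_comm (integrable_conv A f g x)).symm.trans ?_
  refine integral_congr_ae (.of_forall fun y => ?_)
  change φ.toHom (f y * A.act y (g (y⁻¹ * x))) = _
  rw [map_mul, φ.map_act]
  rfl

end ConvolutionAlgebra

end

end ExoticCrossedProduct

/-! ## The completion of a pre-C⋆-algebra -/

namespace UniformSpace.Completion

noncomputable section

section Mul

variable {𝕜 E : Type*} [NontriviallyNormedField 𝕜] [NonUnitalSeminormedRing E] [NormedSpace 𝕜 E]
  [IsScalarTower 𝕜 E E] [SMulCommClass 𝕜 E E]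

theorem clm_ext {L M : Completion E →L[𝕜] Completion E} (h : ∀ b : E, L b = M b) : L = M :=
  ContinuousLinearMap.coeFn_injective (UniformSpace.Completion.ext L.continuous M.continuous h)

variable (𝕜) in
/-- Left multiplication by an element of `E`, extended to the completion. -/
def leftMul (a : E) : Completion E →L[𝕜] Completion E :=
  (ContinuousLinearMap.mul 𝕜 E a).completion

theorem leftMul_coe (a b : E) : leftMul 𝕜 a (b : Completion E) = ((a * b : E) : Completion E) :=
  UniformSpace.Completion.map_coe (ContinuousLinearMap.mul 𝕜 E a).uniformContinuous b

theorem leftMul_add (a b : E) : leftMul 𝕜 (a + b) = leftMul 𝕜 a + leftMul 𝕜 b := by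
  refine clm_ext fun x => ?_
  rw [_root_.add_apply, leftMul_coe (𝕜 := 𝕜), leftMul_coe (𝕜 := 𝕜), leftMul_coe (𝕜 := 𝕜),
    add_mul, coe_add]

theorem leftMul_smul (c : 𝕜) (a : E) : leftMul 𝕜 (c • a) = c • leftMul 𝕜 a := by
  refine clm_ext fun x => ?_
  rw [_root_.smul_apply, leftMul_coe (𝕜 := 𝕜), leftMul_coe (𝕜 := 𝕜), smul_mul_assoc, coe_smul]

theorem norm_leftMul_le (a : E) : ‖leftMul 𝕜 a‖ ≤ ‖a‖ := by
  refine ContinuousLinearMap.opNorm_le_bound _ (norm_nonneg a) fun x => ?_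
  induction x using induction_on with
  | hp => exact isClosed_le (by fun_prop) (by fun_prop)
  | ih x =>
    rw [leftMul_coe (𝕜 := 𝕜), norm_coe, norm_coe]
    exact norm_mul_le a x

variable (𝕜 E) in
/-- Left multiplication as a linear map into the operators on the completion. -/
def leftMulₗ : E →ₗ[𝕜] (Completion E →L[𝕜] Completion E) where
  toFun := leftMul 𝕜
  map_add' := leftMul_add
  map_smul' c a := by rw [RingHom.id_apply, leftMul_smul]

variable (𝕜 E) in
/-- Left multiplication as a continuous linear map into the operators on the completion. -/
def leftMulCLM : E →L[𝕜] (Completion E →L[𝕜] Completion E) :=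
  ⟨leftMulₗ 𝕜 E, AddMonoidHomClass.continuous_of_bound (leftMulₗ 𝕜 E) 1 fun a =>
    (norm_leftMul_le a).trans_eq (one_mul _).symm⟩

variable (𝕜 E) in
/-- The multiplication of the completion as a continuous bilinear map. -/
def mulCLM : Completion E →L[𝕜] Completion E →L[𝕜] Completion E :=
  (leftMulCLM 𝕜 E).extend (toComplL (𝕜 := 𝕜) (E := E))

theorem mulCLM_coe (a b : E) :
    mulCLM 𝕜 E (a : Completion E) b = ((a * b : E) : Completion E) := by
  have h : mulCLM 𝕜 E (a : Completion E) = leftMulCLM 𝕜 E a :=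
    ContinuousLinearMap.extend_eq _ denseRange_coe (isUniformInducing_coe E) a
  rw [h]
  exact leftMul_coe (𝕜 := 𝕜) a b

@[fun_prop]
theorem continuous_mulCLM {X : Type*} [TopologicalSpace X] {f g : X → Completion E}
    (hf : Continuous f) (hg : Continuous g) : Continuous fun x => mulCLM 𝕜 E (f x) (g x) :=
  ((mulCLM 𝕜 E).continuous.comp hf).clm_apply hg

theorem mulCLM_assoc (x y z : Completion E) :
    mulCLM 𝕜 E (mulCLM 𝕜 E x y) z = mulCLM 𝕜 E x (mulCLM 𝕜 E y z) := by
  induction x, y, z using induction_on₃ with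
  | hp => exact isClosed_eq (by fun_prop) (by fun_prop)
  | ih a b c => rw [mulCLM_coe, mulCLM_coe, mulCLM_coe, mulCLM_coe, mul_assoc]

theorem norm_mulCLM_le (x y : Completion E) : ‖mulCLM 𝕜 E x y‖ ≤ ‖x‖ * ‖y‖ := by
  induction x, y using induction_on₂ with
  | hp => exact isClosed_le (by fun_prop) (by fun_prop)
  | ih a b =>
    rw [mulCLM_coe, norm_coe, norm_coe, norm_coe]
    exact norm_mul_le a b

end Mul

section Star

variable {E : Type*} [SeminormedAddCommGroup E] [StarAddMonoid E] [NormedStarGroup E]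

variable (E) in
/-- The extension of an isometric involution to the completion. -/
def starMap : Completion E → Completion E := Completion.map star

theorem starMap_coe (a : E) : starMap E a = ((star a : E) : Completion E) :=
  map_coe (starNormedAddGroupHom (E := E)).uniformContinuous a

@[fun_prop]
theorem continuous_starMap {X : Type*} [TopologicalSpace X] {f : X → Completion E}
    (hf : Continuous f) : Continuous fun x => starMap E (f x) :=
  continuous_map.comp hf

theorem starMap_starMap (x : Completion E) : starMap E (starMap E x) = x := by
  induction x using induction_on with
  | hp => exact isClosed_eq (by fun_prop) (by fun_prop)
  | ih a => rw [starMap_coe, starMap_coe, star_star]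

theorem starMap_add (x y : Completion E) : starMap E (x + y) = starMap E x + starMap E y := by
  induction x, y using induction_on₂ with
  | hp => exact isClosed_eq (by fun_prop) (by fun_prop)
  | ih a b => rw [← coe_add, starMap_coe, starMap_coe, starMap_coe, star_add, coe_add]

theorem starMap_smul {𝕜 : Type*} [NormedField 𝕜] [StarRing 𝕜] [NormedSpace 𝕜 E] [StarModule 𝕜 E]
    (c : 𝕜) (x : Completion E) :
    starMap E (c • x) = star c • starMap E x := by
  induction x using induction_on with
  | hp =>
    exact isClosed_eq (continuous_starMap (continuous_const_smul c))
      ((continuous_starMap continuous_id).const_smul (star c))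
  | ih a => rw [← coe_smul, starMap_coe, starMap_coe, star_smul, coe_smul]

end Star

variable {E : Type*} [NonUnitalSeminormedRing E] [NormedSpace ℂ E] [IsScalarTower ℂ E E]
  [SMulCommClass ℂ E E] [StarRing E] [StarModule ℂ E] [NormedStarGroup E]

theorem starMap_mulCLM (x y : Completion E) :
    starMap E (mulCLM ℂ E x y) = mulCLM ℂ E (starMap E y) (starMap E x) := by
  induction x, y using induction_on₂ with
  | hp => exact isClosed_eq (by fun_prop) (by fun_prop)
  | ih a b => rw [mulCLM_coe, starMap_coe, starMap_coe, starMap_coe, mulCLM_coe, star_mul]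

theorem norm_mul_self_le_mulCLM (h : ∀ a : E, ‖a‖ * ‖a‖ ≤ ‖star a * a‖) (x : Completion E) :
    ‖x‖ * ‖x‖ ≤ ‖mulCLM ℂ E (starMap E x) x‖ := by
  induction x using induction_on with
  | hp => exact isClosed_le (by fun_prop) (by fun_prop)
  | ih a =>
    rw [starMap_coe, mulCLM_coe, norm_coe, norm_coe]
    exact h a

/-- The completion of a pre-C⋆-algebra is a C⋆-algebra. -/
abbrev nonUnitalCStarAlgebra (h : ∀ a : E, ‖a‖ * ‖a‖ ≤ ‖star a * a‖) :
    NonUnitalCStarAlgebra (Completion E) where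
  __ := (inferInstance : NormedAddCommGroup (Completion E))
  __ := (inferInstance : NormedSpace ℂ (Completion E))
  mul x y := mulCLM ℂ E x y
  left_distrib x y z := map_add (mulCLM ℂ E x) y z
  right_distrib x y z := DFunLike.congr_fun (map_add (mulCLM ℂ E) x y) z
  zero_mul x := DFunLike.congr_fun (map_zero (mulCLM ℂ E)) x
  mul_zero x := map_zero (mulCLM ℂ E x)
  mul_assoc := mulCLM_assoc
  norm_mul_le := norm_mulCLM_le
  star := starMap E
  star_involutive := starMap_starMap
  star_mul := starMap_mulCLM
  star_add := starMap_add
  complete := CompleteSpace.complete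
  norm_mul_self_le := norm_mul_self_le_mulCLM h
  smul_assoc c x y := DFunLike.congr_fun (map_smul (mulCLM ℂ E) c x) y
  smul_comm c x y := (map_smul (mulCLM ℂ E x) c y).symm
  star_smul := starMap_smul

end

end UniformSpace.Completion

namespace ExoticCrossedProduct

noncomputable section

/-! ## The C⋆-algebra structure of the crossed product -/

namespace CrossedProductFunctor

variable {G : Type u} [Group G] [TopologicalSpace G] [IsTopologicalGroup G]
  [LocallyCompactSpace G] [MeasurableSpace G] [BorelSpace G] (μ : CrossedProductFunctor G)

instance (A : GAlgebra G) : NonUnitalSeminormedRing (μ.Alg A) where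
  __ := (inferInstance : SeminormedAddCommGroup (μ.Alg A))
  mul f g := conv A f g
  left_distrib := conv_add_right A
  right_distrib := conv_add_left A
  zero_mul := conv_zero_left A
  mul_zero := conv_zero_right A
  mul_assoc := conv_assoc A
  norm_mul_le := μ.conv_le A

instance (A : GAlgebra G) : IsScalarTower ℂ (μ.Alg A) (μ.Alg A) := ⟨conv_smul_left A⟩

instance (A : GAlgebra G) : SMulCommClass ℂ (μ.Alg A) (μ.Alg A) :=
  ⟨fun c f g => (conv_smul_right A c f g).symm⟩

instance (A : GAlgebra G) : StarRing (μ.Alg A) where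
  star f := invol A f
  star_involutive := invol_invol A
  star_mul := invol_conv A
  star_add := invol_add A

instance (A : GAlgebra G) : StarModule ℂ (μ.Alg A) := ⟨invol_smul A⟩

theorem norm_mul_self_eq (A : GAlgebra G) (f : μ.Alg A) : ‖f‖ * ‖f‖ = ‖star f * f‖ :=
  ((μ.cstar A f).trans (sq _)).symm

/-- The C⋆-identity gives `‖f⋆‖² = ‖f f⋆‖ ≤ ‖f‖ ‖f⋆‖`, and `‖f⋆‖` cancels unless it is zero. -/
instance (A : GAlgebra G) : NormedStarGroup (μ.Alg A) where
  norm_star_le f := by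
    by_contra! hlt
    have h := (μ.norm_mul_self_eq A (star f)).trans_le (norm_mul_le _ _)
    rw [star_star] at h
    have hpos : 0 < ‖star f‖ := (norm_nonneg _).trans_lt hlt
    exact absurd (le_of_mul_le_mul_right h hpos) hlt.not_ge

instance (A : GAlgebra G) : NonUnitalCStarAlgebra (μ.Crossed A) :=
  UniformSpace.Completion.nonUnitalCStarAlgebra fun f => (μ.norm_mul_self_eq A f).le

theorem toCrossed_conv (A : GAlgebra G) (f g : C_c(G, A)) :
    μ.toCrossed A (conv A f g) = μ.toCrossed A f * μ.toCrossed A g :=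
  (UniformSpace.Completion.mulCLM_coe (μ.toAlg A f) (μ.toAlg A g)).symm

theorem toCrossed_invol (A : GAlgebra G) (f : C_c(G, A)) :
    μ.toCrossed A (invol A f) = star (μ.toCrossed A f) :=
  (UniformSpace.Completion.starMap_coe (μ.toAlg A f)).symm

theorem denseRange_toCrossed (A : GAlgebra G) : DenseRange (μ.toCrossed A) :=
  UniformSpace.Completion.denseRange_coe (α := μ.Alg A)

/-- The induced map between crossed products is a ⋆-homomorphism. -/
def descentHom {A B : GAlgebra G} (φ : GHom A B) : μ.Crossed A →⋆ₙₐ[ℂ] μ.Crossed B where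
  toFun := μ.descent φ
  map_smul' := map_smul _
  map_zero' := map_zero _
  map_add' := map_add _
  map_mul' x y := by
    refine (μ.denseRange_toCrossed A).induction_on₂
      (isClosed_eq (by fun_prop) (by fun_prop)) (fun f g => ?_) x y
    rw [← toCrossed_conv, descent_toCrossed, descent_toCrossed, descent_toCrossed, mapCc_conv,
      toCrossed_conv]
  map_star' x := by
    refine (μ.denseRange_toCrossed A).induction_on x
      (isClosed_eq (by fun_prop) (by fun_prop)) fun f => ?_
    rw [← toCrossed_invol, descent_toCrossed, descent_toCrossed, mapCc_invol, toCrossed_invol]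

theorem norm_descent_le {A B : GAlgebra G} (φ : GHom A B) (x : μ.Crossed A) :
    ‖μ.descent φ x‖ ≤ ‖x‖ :=
  NonUnitalStarAlgHom.norm_apply_le (μ.descentHom φ) x

/-- Injective ⋆-homomorphisms of C⋆-algebras are isometric. This turns the ideal property, which
asserts injectivity only, into an equality of norms. -/
theorem norm_descent_of_injective {A B : GAlgebra G} (φ : GHom A B)
    (hφ : Injective (μ.descent φ)) (x : μ.Crossed A) : ‖μ.descent φ x‖ = ‖x‖ :=
  NonUnitalStarAlgHom.norm_map (μ.descentHom φ) hφ x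

end CrossedProductFunctor

/-! ## Comparison of quotient norms -/

theorem le_norm_mkQ {E : Type*} [SeminormedAddCommGroup E] [Module ℂ E] {S : Submodule ℂ E}
    {r : ℝ} {x : E} (h : ∀ k ∈ S, r ≤ ‖x - k‖) : r ≤ ‖S.mkQ x‖ := by
  refine le_of_forall_pos_le_add fun ε hε => ?_
  obtain ⟨m, hm, hmn⟩ := Submodule.Quotient.norm_mk_lt (S.mkQ x) hε
  have hk : x - m ∈ S := (Submodule.Quotient.eq S).1 hm.symm
  have := h _ hk
  rw [sub_sub_cancel] at this
  exact this.trans hmn.le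

theorem norm_mkQ_le_norm_sub {E : Type*} [SeminormedAddCommGroup E] [Module ℂ E]
    {S : Submodule ℂ E} {x k : E} (hk : k ∈ S) : ‖S.mkQ x‖ ≤ ‖x - k‖ := by
  have h0 : S.mkQ k = 0 := (Submodule.Quotient.mk_eq_zero S).2 hk
  have h : S.mkQ x = S.mkQ (x - k) := by rw [map_sub, h0, sub_zero]
  rw [h]
  exact Submodule.Quotient.norm_mk_le S _

theorem exists_norm_le_one_norm_mul_sub_lt {E : Type*} [NonUnitalCStarAlgebra E] (x : E) {ε : ℝ}
    (hε : 0 < ε) : ∃ v : E, ‖v‖ ≤ 1 ∧ ‖v * x - x‖ < ε := by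
  -- The order serves only to access the canonical approximate unit.
  let _ : PartialOrder E := CStarAlgebra.spectralOrder E
  have _ : StarOrderedRing E := CStarAlgebra.spectralOrderedRing E
  have h := CStarAlgebra.increasingApproximateUnit E
  have := h.neBot
  have h1 := (tendsto_iff_norm_sub_tendsto_zero.1 (h.tendsto_mul_right x)).eventually_lt_const hε
  obtain ⟨v, hv, hv'⟩ := (h1.and h.eventually_norm).exists
  exact ⟨v, hv', hv⟩

theorem GHom.isometry {G : Type u} [Group G] [TopologicalSpace G] {A B : GAlgebra G}
    (φ : GHom A B) (hφ : Injective φ) : Isometry φ :=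
  NonUnitalStarAlgHom.isometry φ.toHom hφ

/-- A compactly supported function with values in the range of an injective equivariant
⋆-homomorphism lifts. -/
theorem exists_mapCc_eq {G : Type u} [Group G] [TopologicalSpace G] {A B : GAlgebra G}
    (φ : GHom A B) (hφ : Injective φ) (f : C_c(G, B)) (hf : ∀ x, ∃ a, φ a = f x) :
    ∃ g : C_c(G, A), mapCc φ g = f := by
  choose g hg using hf
  refine ⟨⟨⟨g, ?_⟩, ?_⟩, ?_⟩
  -- `φ` is isometric, so continuity of the pointwise lift can be tested after applying `φ`.
  · rw [(φ.isometry hφ).isEmbedding.continuous_iff]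
    exact f.continuous.congr fun x => (hg x).symm
  · refine f.hasCompactSupport.mono fun x hx hfx => hx (hφ ?_)
    rw [hg, hfx]
    exact (map_zero φ.toHom).symm
  · ext x
    exact hg x

/-! ### Comparison of `π`-norms for two surjections onto the same algebra. -/

namespace CrossedProductFunctor

variable {G : Type u} [Group G] [TopologicalSpace G] [IsTopologicalGroup G]
  [LocallyCompactSpace G] [MeasurableSpace G] [BorelSpace G] (μ : CrossedProductFunctor G)

theorem piNorm_eq {C A : GAlgebra G} (π : GHom C A) (hπ : Surjective π) (c : C_c(G, C)) :
    μ.piNorm π hπ (mapCc π c) = ‖(μ.kernelCrossed π).mkQ (μ.toCrossed C c)‖ := by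
  rw [piNorm, quotientInclusion_mapCc]

theorem descent_mem_kernelCrossed {C D A : GAlgebra G} {π : GHom C A} {π' : GHom D A}
    (φ : GHom D C) (h : ∀ d, π (φ d) = π' d) {x : μ.Crossed D} (hx : x ∈ μ.kernelCrossed π') :
    μ.descent φ x ∈ μ.kernelCrossed π := by
  refine map_mem_closure (μ.descent φ).continuous hx ?_
  rintro _ ⟨f, hf, rfl⟩
  refine ⟨mapCc φ f, ?_, (μ.descent_toCrossed φ f).symm⟩
  ext x
  exact (h (f x)).trans (DFunLike.congr_fun (show mapCc π' f = 0 from hf) x)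

/-- The `π`-norm grows when the surjection `π` is replaced by one that factors through it. -/
theorem piNorm_le_of_factor {C D A : GAlgebra G} (π : GHom C A) (hπ : Surjective π)
    (π' : GHom D A) (hπ' : Surjective π') (φ : GHom D C) (h : ∀ d, π (φ d) = π' d)
    (a : C_c(G, A)) : μ.piNorm π hπ a ≤ μ.piNorm π' hπ' a := by
  obtain ⟨d, rfl⟩ := mapCc_surjective π' hπ' a
  have hd : mapCc π' d = mapCc π (mapCc φ d) := by
    ext x
    exact (h (d x)).symm
  rw [piNorm_eq, hd, piNorm_eq]
  -- Every competitor `k` in the kernel for `D` descends to a competitor in the kernel for `C`, at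
  -- no greater distance.
  refine le_norm_mkQ fun k hk => ?_
  rw [← descent_toCrossed]
  refine (norm_mkQ_le_norm_sub (μ.descent_mem_kernelCrossed φ h hk)).trans ?_
  rw [← map_sub]
  exact μ.norm_descent_le φ _

/-- The integrand of the convolution takes values in the ideal. For fixed `x` it lifts to a
compactly supported function into `C`, whose integral is a preimage of the value at `x`. -/
theorem exists_mapCc_eq_conv {C D : GAlgebra G} (φ : GHom C D) (hφ : Injective φ)
    (hideal : ∀ (c : C) (d : D), ∃ y, φ y = φ c * d) (f : C_c(G, C)) (k : C_c(G, D)) :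
    ∃ g : C_c(G, C), mapCc φ g = conv D (mapCc φ f) k := by
  refine exists_mapCc_eq φ hφ _ fun x => ?_
  let F : C_c(G, D) :=
    { toFun := fun y => mapCc φ f y * D.act y (k (y⁻¹ * x))
      continuous_toFun := (mapCc φ f).continuous.mul (D.continuous_act_uncurry.comp
        (continuous_id.prodMk (k.continuous.comp (continuous_id.inv.mul continuous_const))))
      hasCompactSupport' := (mapCc φ f).hasCompactSupport.mul_right }
  obtain ⟨g, hg⟩ := exists_mapCc_eq φ hφ F fun y => hideal (f y) _
  refine ⟨∫ y, g y ∂Measure.haar, ?_⟩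
  refine (φ.toCLM.integral_comp_comm
    (g.continuous.integrable_of_hasCompactSupport g.hasCompactSupport)).symm.trans ?_
  exact integral_congr_ae (.of_forall fun y => DFunLike.congr_fun hg y)

/-- A product of an element of `C` with one of `ker π'` lies in `C ∩ ker π' = ker π`. The same holds
for convolutions of compactly supported functions, and density extends it first to all `v`, then to
all `k`. -/
theorem descent_mul_mem {C D A : GAlgebra G} (ι : GHom C D) (hι : Injective ι)
    (hideal : ∀ (c : C) (d : D), ∃ y, ι y = ι c * d) (hinj : Injective (μ.descent ι))
    (π : GHom C A) (π' : GHom D A) (h : ∀ c, π' (ι c) = π c) (v : μ.Crossed C)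
    {k : μ.Crossed D} (hk : k ∈ μ.kernelCrossed π') :
    ∃ w ∈ μ.kernelCrossed π, μ.descent ι w = μ.descent ι v * k := by
  -- Both limits stay in this image because an isometry from a complete space is a closed map.
  have hclosed : IsClosed (μ.descent ι '' (μ.kernelCrossed π : Set (μ.Crossed C))) :=
    (AddMonoidHomClass.isometry_of_norm (μ.descent ι)
      (μ.norm_descent_of_injective ι hinj)).isClosedEmbedding.isClosedMap _
        (Submodule.isClosed_topologicalClosure _)
  refine (μ.denseRange_toCrossed C).induction_on
    (p := fun v => μ.descent ι v * k ∈ μ.descent ι '' (μ.kernelCrossed π : Set (μ.Crossed C)))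
    v (hclosed.preimage (by fun_prop)) fun f => ?_
  refine hclosed.closure_subset (map_mem_closure
    (f := fun k => μ.descent ι (μ.toCrossed C f) * k) (by fun_prop) hk ?_)
  rintro _ ⟨k, hk, rfl⟩
  obtain ⟨g, hg⟩ := exists_mapCc_eq_conv ι hι hideal f k
  refine ⟨μ.toCrossed C g, Submodule.le_topologicalClosure _ ⟨g, ?_, rfl⟩, ?_⟩
  · have h1 : mapCc π g = mapCc π' (mapCc ι g) := by
      ext x
      exact (h (g x)).symm
    change mapCc π g = 0
    rw [h1, hg, mapCc_conv, show mapCc π' k = 0 from hk, conv_zero_right]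
  · rw [descent_toCrossed, descent_toCrossed, hg, toCrossed_conv]

/-- Under the ideal property, the `π`-norm of a surjection `C → A` is dominated by the norm of any
extension of the surjection to a `G`-algebra that contains `C` as an ideal. -/
theorem piNorm_le_of_ideal (hμ : μ.IdealProperty) {C D A : GAlgebra G} (ι : GHom C D)
    (hι : Injective ι)
    (hideal : ∀ (c : C) (d : D), (∃ y, ι y = d * ι c) ∧ (∃ y, ι y = ι c * d))
    (π : GHom C A) (hπ : Surjective π) (π' : GHom D A) (hπ' : Surjective π')
    (h : ∀ c, π' (ι c) = π c) (a : C_c(G, A)) : μ.piNorm π hπ a ≤ μ.piNorm π' hπ' a := by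
  have hinj : Injective (μ.descent ι) := hμ C D ι hι hideal
  obtain ⟨c, rfl⟩ := mapCc_surjective π hπ a
  have hc : mapCc π c = mapCc π' (mapCc ι c) := by
    ext x
    exact (h (c x)).symm
  rw [piNorm_eq, hc, piNorm_eq, ← descent_toCrossed]
  refine le_norm_mkQ fun k hk => le_of_forall_pos_le_add fun ε hε => ?_
  obtain ⟨v, hv, hvc⟩ := exists_norm_le_one_norm_mul_sub_lt (μ.toCrossed C c) hε
  obtain ⟨w, hw, hwk⟩ := μ.descent_mul_mem ι hι (fun c d => (hideal c d).2) hinj π π' h v hk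
  set x := μ.toCrossed C c
  have hmul : μ.descent ι (v * x) = μ.descent ι v * μ.descent ι x := map_mul (μ.descentHom ι) v x
  -- Multiplication by the contraction `v` moves `k` to `w` in the smaller kernel without increasing
  -- the distance, while `v * x` remains within `ε` of `x`.
  have h1 : ‖v * x - w‖ ≤ ‖μ.descent ι x - k‖ := by
    rw [← μ.norm_descent_of_injective ι hinj, map_sub, hwk, hmul, ← mul_sub]
    refine (norm_mul_le _ _).trans ?_
    exact mul_le_of_le_one_left (norm_nonneg _) ((μ.norm_descent_le ι v).trans hv)
  calc ‖(μ.kernelCrossed π).mkQ x‖ ≤ ‖x - w‖ := norm_mkQ_le_norm_sub hw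
    _ = ‖(v * x - w) - (v * x - x)‖ := by rw [sub_sub_sub_cancel_left]
    _ ≤ ‖v * x - w‖ + ‖v * x - x‖ := norm_sub_le _ _
    _ ≤ _ := add_le_add h1 hvc.le

end CrossedProductFunctor

/-! ## The unitization of a `G`-algebra -/

section Unitization

variable {G : Type u} [Group G] [TopologicalSpace G]

theorem GAlgebra.starMap_act_apply (C : GAlgebra G) (g : G) (a : Unitization ℂ C) :
    Unitization.starMap (C.act g) a =
      Unitization.inl a.fst + ((C.act g a.snd : C) : Unitization ℂ C) := by
  ext <;> simp [Unitization.algebraMap_eq_inl]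

/-- The unitization of a `G`-algebra. -/
def GAlgebra.unitization (C : GAlgebra G) : GAlgebra G where
  carrier := Unitization ℂ C
  act g := (Unitization.starMap (C.act g) : Unitization ℂ C →⋆ₐ[ℂ] Unitization ℂ C)
  act_one a := (C.starMap_act_apply 1 a).trans (by ext <;> simp [C.act_one])
  act_mul g h a := by
    change Unitization.starMap _ a = Unitization.starMap _ (Unitization.starMap _ a)
    ext <;> simp [C.starMap_act_apply, C.act_mul]
  continuous_act a := (continuous_const.add (Unitization.continuous_inr.comp
    (C.continuous_act a.snd))).congr fun g => (C.starMap_act_apply g a).symm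

theorem GAlgebra.isUnital_unitization (C : GAlgebra G) : C.unitization.IsUnital :=
  ⟨(1 : Unitization ℂ C), fun a =>
    ⟨one_mul (M := Unitization ℂ C) a, mul_one (M := Unitization ℂ C) a⟩⟩

/-- The inclusion of a `G`-algebra into its unitization. -/
def GAlgebra.toUnitization (C : GAlgebra G) : GHom C C.unitization where
  toHom := Unitization.inrNonUnitalStarAlgHom ℂ C
  map_act g a := (Unitization.starMap_inr (C.act g) a).symm

theorem GAlgebra.toUnitization_injective (C : GAlgebra G) : Injective C.toUnitization :=
  Unitization.inr_injective

theorem GAlgebra.toUnitization_ideal (C : GAlgebra G) (c : C) (d : C.unitization) :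
    (∃ y, C.toUnitization y = d * C.toUnitization c) ∧
      ∃ y, C.toUnitization y = C.toUnitization c * d := by
  have h : ∀ d : Unitization ℂ C, (∃ y : C, (y : Unitization ℂ C) = d * (c : Unitization ℂ C)) ∧
      ∃ y : C, (y : Unitization ℂ C) = (c : Unitization ℂ C) * d := fun d =>
    ⟨⟨d.fst • c + d.snd * c, by ext <;> simp⟩, ⟨d.fst • c + c * d.snd, by ext <;> simp⟩⟩
  exact h d

/-- The unital extension of an equivariant ⋆-homomorphism into a unital `G`-algebra. -/
def GHom.unitalExtension {C A : GAlgebra G} (π : GHom C A) (e : A)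
    (he : ∀ a : A, e * a = a ∧ a * e = a) : GHom C.unitization A :=
  -- A two-sided unit is self-adjoint and fixed by the action; these facts make the extension
  -- ⋆-preserving and equivariant.
  have hstar : star e = e := by
    have h := (he (star e)).1
    calc star e = star (star (e * star e)) := by rw [star_star, h]
      _ = star (e * star e) := congrArg star (by rw [star_mul, star_star])
      _ = e := by rw [h, star_star]
  have hact : ∀ g, A.act g e = e := fun g => by
    have h := (he (A.act g⁻¹ e)).1
    have h2 := congrArg (A.act g) h
    rw [map_mul, ← A.act_mul, mul_inv_cancel, A.act_one, (he _).2] at h2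
    exact h2
  { toHom :=
      { toFun := fun x : Unitization ℂ C => x.fst • e + π x.snd
        map_smul' := fun c x => by
          change (c * x.fst) • e + π.toHom (c • x.snd) = c • (x.fst • e + π.toHom x.snd)
          rw [map_smul, smul_add, smul_smul]
        map_zero' := by
          change (0 : ℂ) • e + π.toHom 0 = 0
          rw [map_zero, zero_smul, add_zero]
        map_add' := fun x y => by
          change (x.fst + y.fst) • e + π.toHom (x.snd + y.snd) =
            x.fst • e + π.toHom x.snd + (y.fst • e + π.toHom y.snd)
          rw [map_add, add_smul]
          abel
        map_mul' := fun x y => by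
          change (x.fst * y.fst) • e +
              π.toHom (x.fst • y.snd + y.fst • x.snd + x.snd * y.snd) =
            (x.fst • e + π.toHom x.snd) * (y.fst • e + π.toHom y.snd)
          simp only [map_add, map_smul, map_mul, add_mul, mul_add, smul_mul_assoc, mul_smul_comm,
            (he _).1, (he _).2, smul_add, smul_smul, mul_comm y.fst]
          abel
        map_star' := fun x => by
          change star x.fst • e + π.toHom (star x.snd) = star (x.fst • e + π.toHom x.snd)
          rw [star_add, star_smul, hstar, map_star] }
    map_act := fun g (x : Unitization ℂ C) => by
      change (Unitization.starMap (C.act g) x).fst • e +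
        π.toHom (Unitization.starMap (C.act g) x).snd = A.act g (x.fst • e + π.toHom x.snd)
      rw [C.starMap_act_apply, map_add, map_smul, hact, ← π.map_act]
      simp }

theorem GHom.unitalExtension_toUnitization {C A : GAlgebra G} (π : GHom C A) (e : A)
    (he : ∀ a : A, e * a = a ∧ a * e = a) (c : C) :
    π.unitalExtension e he (C.toUnitization c) = π c := by
  change (0 : ℂ) • e + π c = π c
  rw [zero_smul, zero_add]

end Unitization

end

end ExoticCrossedProduct

/-! ### Surjectivity by successive approximation. -/

/-- A continuous additive map from a complete group is surjective if every element of the target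
has approximate preimages of controlled norm. -/
theorem surjective_of_approx_preimage {E F : Type*} [NormedAddCommGroup E] [CompleteSpace E]
    [NormedAddCommGroup F] (T : E →+ F) (hT : Continuous T) (K : ℝ)
    (h : ∀ y, ∃ x, ‖x‖ ≤ K * ‖y‖ ∧ ‖y - T x‖ ≤ ‖y‖ / 2) : Surjective T := by
  choose f hf hf' using h
  intro y
  -- `r n` is the error left after `n` corrections; it at least halves at each step, so the series
  -- of corrections converges.
  let r : ℕ → F := fun n => Nat.rec y (fun _ z => z - T (f z)) n
  have hr0 : r 0 = y := rfl
  have hr : ∀ n, r (n + 1) = r n - T (f (r n)) := fun n => rfl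
  have hrn : ∀ n, ‖r n‖ ≤ ‖y‖ * (1 / 2) ^ n := by
    intro n
    induction n with
    | zero => simp [hr0]
    | succ n ih =>
      rw [hr, pow_succ]
      refine (hf' (r n)).trans ?_
      linarith
  have hgeom : Summable fun n : ℕ => |K| * (‖y‖ * (1 / 2 : ℝ) ^ n) :=
    (summable_geometric_two.mul_left _).mul_left _
  have hsum : Summable fun n => f (r n) := by
    refine Summable.of_norm_bounded hgeom fun n => (hf (r n)).trans ?_
    exact mul_le_mul (le_abs_self K) (hrn n) (norm_nonneg _) (abs_nonneg K)
  have hpartial : ∀ n, T (∑ k ∈ Finset.range n, f (r k)) = y - r n := by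
    intro n
    induction n with
    | zero => simp [hr0]
    | succ n ih =>
      rw [Finset.sum_range_succ, map_add, ih, hr]
      abel
  refine ⟨∑' n, f (r n), ?_⟩
  have h1 := (hT.tendsto _).comp hsum.hasSum.tendsto_sum_nat
  have h2 : Tendsto r atTop (𝓝 0) := by
    refine squeeze_zero_norm hrn ?_
    simpa using (tendsto_pow_atTop_nhds_zero_of_lt_one (r := (1 / 2 : ℝ))
      (by norm_num) (by norm_num)).const_mul ‖y‖
  refine tendsto_nhds_unique h1 ?_
  simpa [comp_def, hpartial] using h2.const_sub y

/-! ## Lifting along surjective ⋆-homomorphisms with norm control -/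

section Lift

variable {C A : Type*} [NonUnitalCStarAlgebra C] [NonUnitalCStarAlgebra A]

/-- The real part of any lift is a self-adjoint lift. Functional calculus with the clamp to `[-‖a‖,
‖a‖]` bounds its norm and does not change its image, since the clamp is the identity on the spectrum
of `a`. -/
theorem IsSelfAdjoint.exists_preimage_norm_le {φ : C →⋆ₙₐ[ℂ] A} (hφ : Surjective φ) {a : A}
    (ha : IsSelfAdjoint a) : ∃ c, φ c = a ∧ ‖c‖ ≤ ‖a‖ := by
  obtain ⟨c₀, hc₀⟩ := hφ a
  let c : C := (realPart c₀ : C)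
  have hc : IsSelfAdjoint c := (realPart c₀).2
  have hca : φ c = a := by
    have : c = (2⁻¹ : ℂ) • (c₀ + star c₀) := by
      simp only [c, realPart_apply_coe]
      rw [← Complex.coe_smul]
      norm_num
    rw [this, map_smul, map_add, map_star, hc₀, ha.star_eq, ← two_smul ℂ a, smul_smul]
    norm_num
  let f : ℝ → ℝ := fun t => max (-‖a‖) (min t ‖a‖)
  have hf : Continuous f := by fun_prop
  have hf0 : f 0 = 0 := by simp [f]
  refine ⟨cfcₙ f c, ?_, ?_⟩
  · rw [NonUnitalStarAlgHom.map_cfcₙ φ f c hf.continuousOn hf0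
      (AddMonoidHomClass.continuous_of_bound φ 1 fun x => by
        simpa using NonUnitalStarAlgHom.norm_apply_le φ x) hc (by rw [hca]; exact ha), hca]
    rw [cfcₙ_congr (g := id) fun t ht => ?_, cfcₙ_id ℝ a]
    have h := norm_apply_le_norm_cfcₙ (id : ℝ → ℝ) a ht
    rw [cfcₙ_id ℝ a, id, Real.norm_eq_abs, abs_le] at h
    simp [f, h.1, h.2]
  · refine norm_cfcₙ_le fun t _ => ?_
    rw [Real.norm_eq_abs, abs_le]
    exact ⟨le_max_left _ _, max_le (by linarith [norm_nonneg a]) (min_le_right _ _)⟩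

/-- Real and imaginary parts are lifted separately. The constant 2 is not optimal; what matters is
that it does not depend on `φ`, so lifts chosen for a whole family form a bounded family. -/
theorem NonUnitalStarAlgHom.exists_preimage_norm_le {φ : C →⋆ₙₐ[ℂ] A} (hφ : Surjective φ) (a : A) :
    ∃ c, φ c = a ∧ ‖c‖ ≤ 2 * ‖a‖ := by
  obtain ⟨x, hx, hxn⟩ := (realPart a).2.exists_preimage_norm_le hφ
  obtain ⟨y, hy, hyn⟩ := (imaginaryPart a).2.exists_preimage_norm_le hφ
  refine ⟨x + Complex.I • y, ?_, ?_⟩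
  · rw [map_add, map_smul, hx, hy]
    exact realPart_add_I_smul_imaginaryPart a
  · calc ‖x + Complex.I • y‖ ≤ ‖x‖ + ‖Complex.I • y‖ := norm_add_le _ _
      _ = ‖x‖ + ‖y‖ := by rw [norm_smul, Complex.norm_I, one_mul]
      _ ≤ ‖a‖ + ‖a‖ := add_le_add (hxn.trans (realPart.norm_le a))
        (hyn.trans (imaginaryPart.norm_le a))
      _ = 2 * ‖a‖ := (two_mul _).symm

end Lift

namespace ExoticCrossedProduct

noncomputable section

/-! ## Averaging along the action -/

section Average

variable {G : Type u} [Group G] [TopologicalSpace G] [IsTopologicalGroup G]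
  [LocallyCompactSpace G] [MeasurableSpace G] [BorelSpace G]

theorem exists_bump {V : Set G} (hV : V ∈ 𝓝 (1 : G)) :
    ∃ φ : C_c(G, ℝ), (∀ g, 0 ≤ φ g) ∧ ∫ g, φ g ∂Measure.haar = 1 ∧ ∀ g, φ g ≠ 0 → g ∈ V := by
  obtain ⟨f, hf1, hfc, hfV, hf01⟩ := exists_continuousMap_one_of_isCompact_subset_isOpen
    (isCompact_singleton (x := (1 : G))) isOpen_interior
    (Set.singleton_subset_iff.2 (mem_interior_iff_mem_nhds.2 hV))
  have hpos : 0 < ∫ g, f g ∂Measure.haar :=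
    f.continuous.integral_pos_of_hasCompactSupport_nonneg_nonzero hfc (fun g => (hf01 g).1)
      (x := 1) (by rw [hf1 rfl]; exact one_ne_zero)
  refine ⟨(∫ g, f g ∂Measure.haar)⁻¹ • ⟨f, hfc⟩, fun g => ?_, ?_, fun g hg => ?_⟩
  · exact mul_nonneg (inv_nonneg.2 hpos.le) (hf01 g).1
  · change ∫ g, (∫ g, f g ∂Measure.haar)⁻¹ * f g ∂Measure.haar = 1
    rw [integral_const_mul, inv_mul_cancel₀ hpos.ne']
  · refine interior_subset (hfV (subset_tsupport _ fun h0 => hg ?_))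
    change (∫ g, f g ∂Measure.haar)⁻¹ * f g = 0
    rw [h0, mul_zero]

theorem tendsto_integral_abs_translate_sub (φ : C_c(G, ℝ)) :
    Tendsto (fun h : G => ∫ g, |φ (h⁻¹ * g) - φ g| ∂Measure.haar) (𝓝 1) (𝓝 0) := by
  obtain ⟨t, ht, ht1⟩ := exists_compact_mem_nhds (1 : G)
  have hK : IsCompact (tsupport φ) := φ.hasCompactSupport
  have hcont : ContinuousOn (fun h : G => ∫ g, |φ (h⁻¹ * g) - φ g| ∂Measure.haar) t := by
    -- For `h ∈ t` the integrand is supported in the fixed compact set `t K ∪ K`, where `K` is the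
    -- support of `φ`.
    refine continuousOn_integral_of_compact_support ((ht.mul hK).union hK) ?_ fun h g hh hg => ?_
    · have := φ.continuous
      exact Continuous.continuousOn (by fun_prop)
    · have h1 : φ g = 0 := image_eq_zero_of_notMem_tsupport fun h => hg (Or.inr h)
      have h2 : φ (h⁻¹ * g) = 0 := image_eq_zero_of_notMem_tsupport fun h' =>
        hg (Or.inl ⟨h, hh, _, h', mul_inv_cancel_left h g⟩)
      simp [h1, h2]
  simpa using (hcont.continuousAt ht1).tendsto

/-- The average `∫ φ(g) α_g(a) dg`. -/
def GAlgebra.average (A : GAlgebra G) (φ : G → ℝ) (a : A) : A :=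
  ∫ g, (φ g : ℂ) • A.act g a ∂Measure.haar

theorem GAlgebra.norm_average_le (A : GAlgebra G) (φ : G → ℝ) (a : A) :
    ‖A.average φ a‖ ≤ (∫ g, |φ g| ∂Measure.haar) * ‖a‖ := by
  refine (norm_integral_le_integral_norm _).trans_eq ?_
  rw [← integral_mul_const]
  simp [norm_smul, A.norm_act]

theorem GAlgebra.integrable_average (A : GAlgebra G) (φ : C_c(G, ℝ)) (a : A) :
    Integrable (fun g => (φ g : ℂ) • A.act g a) Measure.haar := by
  refine Continuous.integrable_of_hasCompactSupport ?_ ?_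
  · exact (Complex.continuous_ofReal.comp φ.continuous).smul (A.continuous_act a)
  · refine φ.hasCompactSupport.mono fun g hg hφ => hg ?_
    simp [hφ]

theorem GHom.map_average {C A : GAlgebra G} (π : GHom C A) (φ : C_c(G, ℝ)) (c : C) :
    π (C.average φ c) = A.average φ (π c) := by
  refine (π.toCLM.integral_comp_comm (C.integrable_average φ c)).symm.trans ?_
  refine integral_congr_ae (.of_forall fun g => ?_)
  change π.toHom ((φ g : ℂ) • C.act g c) = _
  rw [map_smul, π.map_act]

/-- Left invariance moves `h` from the algebra to the weight. Hence the orbit of an average varies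
by at most `‖φ(h⁻¹ ·) - φ‖₁ ‖a‖`, a bound whose first factor is the same for every `G`-algebra. -/
theorem GAlgebra.act_average_sub (A : GAlgebra G) (φ : C_c(G, ℝ)) (h : G) (a : A) :
    A.act h (A.average φ a) - A.average φ a = A.average (fun g => φ (h⁻¹ * g) - φ g) a := by
  have h1 : A.act h (A.average φ a) = ∫ g, (φ (h⁻¹ * g) : ℂ) • A.act g a ∂Measure.haar := by
    refine ((A.actCLM h).integral_comp_comm (A.integrable_average φ a)).symm.trans ?_
    rw [← integral_mul_left_eq_self (fun g => (φ (h⁻¹ * g) : ℂ) • A.act g a) h]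
    refine integral_congr_ae (.of_forall fun g => ?_)
    simp only [map_smul, A.actCLM_apply, inv_mul_cancel_left, A.act_mul]
  have h2 : Integrable (fun g => (φ (h⁻¹ * g) : ℂ) • A.act g a) Measure.haar := by
    have := (((A.actCLM h).integrable_comp (A.integrable_average φ a))).comp_mul_left h⁻¹
    refine this.congr (.of_forall fun g => ?_)
    simp only [map_smul, A.actCLM_apply, ← A.act_mul, mul_inv_cancel_left]
  rw [h1, GAlgebra.average, GAlgebra.average, ← integral_sub h2 (A.integrable_average φ a)]
  simp [sub_smul]

theorem GAlgebra.norm_average_sub_le (A : GAlgebra G) (φ : C_c(G, ℝ)) (hφ : ∀ g, 0 ≤ φ g)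
    (hφ1 : ∫ g, φ g ∂Measure.haar = 1) (a : A) {ε : ℝ}
    (h : ∀ g, φ g ≠ 0 → ‖A.act g a - a‖ ≤ ε) : ‖a - A.average φ a‖ ≤ ε := by
  have hint : Integrable φ Measure.haar :=
    φ.continuous.integrable_of_hasCompactSupport φ.hasCompactSupport
  have h1 : a = ∫ g, (φ g : ℂ) • a ∂Measure.haar := by
    rw [integral_smul_const, integral_complex_ofReal, hφ1, Complex.ofReal_one, one_smul]
  have hinta : Integrable (fun g => (φ g : ℂ) • a) Measure.haar := hint.ofReal.smul_const a
  nth_rewrite 1 [h1]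
  rw [norm_sub_rev, GAlgebra.average, ← integral_sub (A.integrable_average φ a) hinta]
  have h2 : ∫ g, φ g * ε ∂Measure.haar = ε := by rw [integral_mul_const, hφ1, one_mul]
  rw [← h2]
  refine norm_integral_le_of_norm_le (hint.mul_const ε) (.of_forall fun g => ?_)
  rw [← smul_sub, norm_smul, Complex.norm_real, Real.norm_of_nonneg (hφ g)]
  by_cases h0 : φ g = 0
  · simp [h0]
  · exact mul_le_mul_of_nonneg_left (h g h0) (hφ g)

end Average

/-! ## Fibre products of families of `G`-algebras -/

section FibreProduct

variable {G : Type u} [Group G] [TopologicalSpace G] {I : Type u} (C : I → GAlgebra G)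

/-- The (in general discontinuous) action of `G` on the `ℓ^∞`-product of `G`-algebras. -/
def lpAct (g : G) : lp (fun i => (C i : Type u)) ∞ →⋆ₙₐ[ℂ] lp (fun i => (C i : Type u)) ∞ where
  toFun c := ⟨fun i => (C i).act g (c i), memℓp_infty ⟨‖c‖, by
    rintro _ ⟨i, rfl⟩
    exact (NonUnitalStarAlgHom.norm_apply_le ((C i).act g) (c i)).trans
      (lp.norm_apply_le_norm ENNReal.top_ne_zero c i)⟩⟩
  map_smul' z c := by ext i; exact map_smul ((C i).act g) z (c i)
  map_zero' := by ext i; exact map_zero ((C i).act g)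
  map_add' c d := by ext i; exact map_add ((C i).act g) (c i) (d i)
  map_mul' c d := by ext i; exact map_mul ((C i).act g) (c i) (d i)
  map_star' c := by ext i; exact map_star ((C i).act g) (c i)

theorem lpAct_apply (g : G) (c : lp (fun i => (C i : Type u)) ∞) (i : I) :
    lpAct C g c i = (C i).act g (c i) := rfl

theorem lpAct_one (c : lp (fun i => (C i : Type u)) ∞) : lpAct C 1 c = c := by
  ext i
  exact (C i).act_one (c i)

theorem lpAct_mul (g h : G) (c : lp (fun i => (C i : Type u)) ∞) :
    lpAct C (g * h) c = lpAct C g (lpAct C h c) := by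
  ext i
  exact (C i).act_mul g h (c i)

/-- Each `lpAct C g₀` is contractive, so continuity at `1` propagates to `g₀` by translation. -/
theorem continuous_lpAct_of_tendsto [IsTopologicalGroup G] {c : lp (fun i => (C i : Type u)) ∞}
    (h : Tendsto (fun g => ‖lpAct C g c - c‖) (𝓝 1) (𝓝 0)) : Continuous fun g => lpAct C g c := by
  refine continuous_iff_continuousAt.2 fun g₀ => ?_
  rw [ContinuousAt, tendsto_iff_norm_sub_tendsto_zero]
  have h1 : Tendsto (fun g => g₀⁻¹ * g) (𝓝 g₀) (𝓝 1) := by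
    have : Continuous fun g => g₀⁻¹ * g := by fun_prop
    simpa using this.tendsto g₀
  refine squeeze_zero (fun _ => norm_nonneg _) (fun g => ?_) (h.comp h1)
  calc ‖lpAct C g c - lpAct C g₀ c‖ = ‖lpAct C g₀ (lpAct C (g₀⁻¹ * g) c - c)‖ := by
        rw [map_sub, ← lpAct_mul, mul_inv_cancel_left]
    _ ≤ _ := NonUnitalStarAlgHom.norm_apply_le (lpAct C g₀) _

variable {C} {A : GAlgebra G} (π : ∀ i, GHom (C i) A)

/-- The families with a common image in `A` and norm continuous orbit. -/
def fibreSubalgebra : NonUnitalStarSubalgebra ℂ (lp (fun i => (C i : Type u)) ∞) where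
  carrier := {c | (∀ i j, (π i).toHom (c i) = (π j).toHom (c j)) ∧
    Continuous fun g => lpAct C g c}
  add_mem' {c d} hc hd := by
    refine ⟨fun i j => ?_, ?_⟩
    · rw [lp.coeFn_add, Pi.add_apply, Pi.add_apply, map_add, map_add, hc.1 i j, hd.1 i j]
    · simp only [map_add]
      exact hc.2.add hd.2
  zero_mem' := by
    refine ⟨fun i j => ?_, ?_⟩
    · rw [lp.coeFn_zero, Pi.zero_apply, Pi.zero_apply, map_zero, map_zero]
    · simp only [map_zero]
      exact continuous_const
  mul_mem' {c d} hc hd := by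
    refine ⟨fun i j => ?_, ?_⟩
    · rw [lp.infty_coeFn_mul, Pi.mul_apply, Pi.mul_apply, map_mul, map_mul, hc.1 i j, hd.1 i j]
    · simp only [map_mul]
      exact hc.2.mul hd.2
  smul_mem' z c hc := by
    refine ⟨fun i j => ?_, ?_⟩
    · rw [lp.coeFn_smul, Pi.smul_apply, Pi.smul_apply, map_smul, map_smul, hc.1 i j]
    · simp only [map_smul]
      exact hc.2.const_smul z
  star_mem' {c} hc := by
    refine ⟨fun i j => ?_, ?_⟩
    · rw [lp.star_apply, lp.star_apply, map_star, map_star, hc.1 i j]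
    · simp only [map_star]
      exact hc.2.star

theorem continuous_lp_apply (i : I) :
    Continuous fun c : lp (fun i => (C i : Type u)) ∞ => c i := by
  refine AddMonoidHomClass.continuous_of_bound
    ({ toFun := fun c => c i, map_zero' := rfl, map_add' := fun _ _ => rfl } :
      lp (fun i => (C i : Type u)) ∞ →+ C i) 1 fun c => ?_
  rw [one_mul]
  exact lp.norm_apply_le_norm ENNReal.top_ne_zero c i

/-- The orbit condition is closed because the maps `lpAct C g` are contractive: norm limits of
families have orbit maps that are uniform limits. Closedness makes the fibre product a C⋆-algebra.
-/
instance isClosed_fibreSubalgebra :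
    IsClosed (fibreSubalgebra π : Set (lp (fun i => (C i : Type u)) ∞)) := by
  have h1 : IsClosed {c : lp (fun i => (C i : Type u)) ∞ | ∀ i j, π i (c i) = π j (c j)} := by
    simp only [Set.ofPred_forall]
    exact isClosed_iInter fun i => isClosed_iInter fun j => isClosed_eq
      ((π i).continuous.comp (continuous_lp_apply i))
      ((π j).continuous.comp (continuous_lp_apply j))
  refine h1.inter (isClosed_of_closure_subset fun c hc => ?_)
  refine continuous_of_uniform_approx_of_continuous fun u hu => ?_
  obtain ⟨ε, hε, hεu⟩ := Metric.mem_uniformity_dist.1 hu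
  obtain ⟨d, hd, hcd⟩ := Metric.mem_closure_iff.1 hc ε hε
  refine ⟨_, hd, fun g => hεu ?_⟩
  rw [dist_eq_norm, ← map_sub]
  refine (NonUnitalStarAlgHom.norm_apply_le (lpAct C g) _).trans_lt ?_
  rwa [← dist_eq_norm]

theorem lpAct_mem [IsTopologicalGroup G] (g : G) {c : lp (fun i => (C i : Type u)) ∞}
    (hc : c ∈ fibreSubalgebra π) : lpAct C g c ∈ fibreSubalgebra π := by
  refine ⟨fun i j => ?_, ?_⟩
  · rw [lpAct_apply, lpAct_apply, (π i).map_act, (π j).map_act, hc.1 i j]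
  · simp only [← lpAct_mul]
    exact hc.2.comp (continuous_mul_const g)

/-- The fibre product of a family of equivariant ⋆-homomorphisms `C i → A`. -/
def fibreProduct [IsTopologicalGroup G] : GAlgebra G where
  carrier := fibreSubalgebra π
  act g :=
    { toFun := fun c => ⟨lpAct C g c, lpAct_mem π g c.2⟩
      map_smul' := fun z c => Subtype.ext (map_smul (lpAct C g) z (c : lp _ ∞))
      map_zero' := Subtype.ext (map_zero (lpAct C g))
      map_add' := fun c d => Subtype.ext (map_add (lpAct C g) (c : lp _ ∞) (d : lp _ ∞))
      map_mul' := fun c d => Subtype.ext (map_mul (lpAct C g) (c : lp _ ∞) (d : lp _ ∞))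
      map_star' := fun c => Subtype.ext (map_star (lpAct C g) (c : lp _ ∞)) }
  act_one c := Subtype.ext (lpAct_one C c)
  act_mul g h c := Subtype.ext (lpAct_mul C g h c)
  continuous_act c := c.2.2.subtype_mk _

/-- The coordinate maps of the fibre product. -/
def fibreProductProj [IsTopologicalGroup G] (i : I) : GHom (fibreProduct π) (C i) where
  toHom :=
    { toFun := fun c : fibreSubalgebra π => (c : lp (fun i => (C i : Type u)) ∞) i
      map_smul' := fun _ _ => rfl
      map_zero' := rfl
      map_add' := fun _ _ => rfl
      map_mul' := fun _ _ => rfl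
      map_star' := fun _ => rfl }
  map_act _ _ := rfl

/-- Composition of equivariant ⋆-homomorphisms. -/
def GHom.comp {A B C : GAlgebra G} (ψ : GHom B C) (φ : GHom A B) : GHom A C where
  toHom := ψ.toHom.comp φ.toHom
  map_act g a := (congrArg ψ (φ.map_act g a)).trans (ψ.map_act g (φ a))

theorem fibreProduct_comp_proj [IsTopologicalGroup G] (i j : I) (c : fibreProduct π) :
    π i (fibreProductProj π i c) = π j (fibreProductProj π j c) :=
  c.2.1 i j

/-- An approximate preimage of `a` is the family of averages of uniformly bounded lifts. Its common
image is the average of `a`, within `‖a‖ / 2` of `a` when the bump function is concentrated near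
`1`. -/
theorem fibreProduct_surjective [IsTopologicalGroup G] [LocallyCompactSpace G]
    (hπ : ∀ i, Surjective (π i)) (i : I) :
    Surjective ((π i).comp (fibreProductProj π i)) := by
  borelize G
  refine surjective_of_approx_preimage
    (((π i).comp (fibreProductProj π i)).toHom : fibreProduct π →+ A)
    ((π i).comp (fibreProductProj π i)).continuous 2 fun a => ?_
  rcases eq_or_ne a 0 with rfl | ha
  · exact ⟨0, by simp⟩
  have hV : {g : G | ‖A.act g a - a‖ < ‖a‖ / 2} ∈ 𝓝 (1 : G) := by
    have hc : Continuous fun g => ‖A.act g a - a‖ :=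
      ((A.continuous_act a).sub continuous_const).norm
    refine hc.continuousAt.eventually_lt_const ?_
    simp only [A.act_one, sub_self, norm_zero]
    exact half_pos (norm_pos_iff.2 ha)
  obtain ⟨φ, hφ, hφ1, hφV⟩ := exists_bump hV
  choose c hca hcn using fun i => NonUnitalStarAlgHom.exists_preimage_norm_le (hπ i) a
  have habs : ∫ g, |φ g| ∂Measure.haar = 1 := by simp only [abs_of_nonneg (hφ _), hφ1]
  have hbound : ∀ i, ‖(C i).average φ (c i)‖ ≤ 2 * ‖a‖ := fun i => by
    refine ((C i).norm_average_le φ (c i)).trans ?_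
    rw [habs, one_mul]
    exact hcn i
  let d : lp (fun i => (C i : Type u)) ∞ :=
    ⟨fun i => (C i).average φ (c i), memℓp_infty ⟨2 * ‖a‖, by
      rintro _ ⟨i, rfl⟩
      exact hbound i⟩⟩
  have hπd : ∀ i, π i (d i) = A.average φ a := fun i =>
    ((π i).map_average φ (c i)).trans (congrArg (A.average φ) (hca i))
  -- The orbit is continuous at `1` in the supremum norm because the bound from `act_average_sub` is
  -- uniform in `i`.
  have hd : d ∈ fibreSubalgebra π := by
    refine ⟨fun i j => (hπd i).trans (hπd j).symm, continuous_lpAct_of_tendsto C ?_⟩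
    have h0 := (tendsto_integral_abs_translate_sub φ).mul_const (2 * ‖a‖)
    rw [zero_mul] at h0
    refine squeeze_zero (fun _ => norm_nonneg _) (fun h => ?_) h0
    refine lp.norm_le_of_forall_le (by positivity) fun i => ?_
    rw [lp.coeFn_sub, Pi.sub_apply, lpAct_apply]
    refine (congrArg norm ((C i).act_average_sub φ h (c i))).trans_le ?_
    exact ((C i).norm_average_le _ _).trans
      (mul_le_mul_of_nonneg_left (hcn i) (by positivity))
  refine ⟨⟨d, hd⟩, lp.norm_le_of_forall_le (by positivity) hbound, ?_⟩
  change ‖a - π i (d i)‖ ≤ ‖a‖ / 2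
  rw [hπd]
  exact A.norm_average_sub_le φ hφ hφ1 a fun g hg => (hφV g hg).le

end FibreProduct

/-! ### Attainment of the `𝓔(μ)`-norm. -/

namespace CrossedProductFunctor

variable {G : Type u} [Group G] [TopologicalSpace G] [IsTopologicalGroup G]
  [LocallyCompactSpace G] [MeasurableSpace G] [BorelSpace G] (μ : CrossedProductFunctor G)

theorem piNorm_le_exactNorm {C A : GAlgebra G} (π : GHom C A) (hπ : Surjective π)
    (a : C_c(G, A)) : ENNReal.ofReal (μ.piNorm π hπ a) ≤ μ.exactNorm A a :=
  le_iSup_of_le C (le_iSup_of_le π (le_iSup_of_le hπ le_rfl))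

/-- The supremum defining the `𝓔(μ)`-norm is attained, by the same surjection for all elements. -/
theorem exists_exactNorm_eq (A : GAlgebra G) :
    ∃ (C : GAlgebra G) (π : GHom C A) (hπ : Surjective π),
      ∀ a : C_c(G, A), μ.exactNorm A a = ENNReal.ofReal (μ.piNorm π hπ a) := by
  -- The index type lies in the universe `u`, so the fibre product is again a `GAlgebra G`. When `r`
  -- is not below the supremum, the identity of `A` serves as a default.
  have key : ∀ p : C_c(G, A) × ℝ≥0, ∃ (C : GAlgebra G) (π : GHom C A) (hπ : Surjective π),
      (p.2 : ℝ≥0∞) < μ.exactNorm A p.1 → (p.2 : ℝ≥0∞) < ENNReal.ofReal (μ.piNorm π hπ p.1) := by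
    intro p
    by_cases hp : (p.2 : ℝ≥0∞) < μ.exactNorm A p.1
    · simp only [exactNorm, lt_iSup_iff] at hp
      obtain ⟨C, π, hπ, h⟩ := hp
      exact ⟨C, π, hπ, fun _ => h⟩
    · exact ⟨A, ⟨NonUnitalStarAlgHom.id ℂ A, fun _ _ => rfl⟩, surjective_id, fun h => absurd h hp⟩
  choose C π hπ hlt using key
  -- The index `0` is arbitrary: on the fibre product all the composites to `A` agree.
  refine ⟨fibreProduct π, (π 0).comp (fibreProductProj π 0), fibreProduct_surjective π hπ 0,
    fun a => le_antisymm ?_ (μ.piNorm_le_exactNorm _ _ a)⟩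
  refine le_of_forall_lt fun r hr => ?_
  lift r to ℝ≥0 using hr.ne_top
  refine (hlt (a, r) hr).trans_le (ENNReal.ofReal_le_ofReal ?_)
  exact μ.piNorm_le_of_factor _ _ _ _ (fibreProductProj π (a, r))
    (fun d => fibreProduct_comp_proj π (a, r) 0 d) a

/-- The norm from the unitization dominates the optimal one by `piNorm_le_of_ideal` and cannot
exceed it, since the `𝓔(μ)`-norm is a supremum. -/
theorem exists_isUnital_exactNorm_eq (hμ : μ.IdealProperty) (A : GAlgebra G) (hA : A.IsUnital) :
    ∃ (C : GAlgebra G) (π : GHom C A) (hπ : Surjective π), C.IsUnital ∧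
      ∀ a : C_c(G, A), μ.exactNorm A a = ENNReal.ofReal (μ.piNorm π hπ a) := by
  obtain ⟨C, π, hπ, h⟩ := μ.exists_exactNorm_eq A
  obtain ⟨e, he⟩ := hA
  have hπ' : Surjective (π.unitalExtension e he) := fun a => by
    obtain ⟨c, rfl⟩ := hπ a
    exact ⟨C.toUnitization c, π.unitalExtension_toUnitization e he c⟩
  refine ⟨C.unitization, π.unitalExtension e he, hπ', C.isUnital_unitization,
    fun a => le_antisymm ?_ (μ.piNorm_le_exactNorm _ _ a)⟩
  rw [h a]
  exact ENNReal.ofReal_le_ofReal (μ.piNorm_le_of_ideal hμ C.toUnitization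
    C.toUnitization_injective C.toUnitization_ideal π hπ _ hπ'
    (π.unitalExtension_toUnitization e he) a)

end CrossedProductFunctor

end

end ExoticCrossedProduct

theorem proposition2p2 {G : Type u} [Group G] [TopologicalSpace G] [IsTopologicalGroup G]
    [LocallyCompactSpace G] [T2Space G] [MeasurableSpace G] [BorelSpace G]
    (μ : ExoticCrossedProduct.CrossedProductFunctor G) (A : ExoticCrossedProduct.GAlgebra G) :
    (∃ (C : ExoticCrossedProduct.GAlgebra G) (π : ExoticCrossedProduct.GHom C A)
      (hπ : Function.Surjective π),
        ∀ a : C_c(G, A), μ.exactNorm A a = ENNReal.ofReal (μ.piNorm π hπ a)) ∧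
    (μ.IdealProperty → A.IsUnital →
      ∃ (C : ExoticCrossedProduct.GAlgebra G) (π : ExoticCrossedProduct.GHom C A)
        (hπ : Function.Surjective π), C.IsUnital ∧
          ∀ a : C_c(G, A), μ.exactNorm A a = ENNReal.ofReal (μ.piNorm π hπ a)) :=
  ⟨μ.exists_exactNorm_eq A, fun hμ hA => μ.exists_isUnital_exactNorm_eq hμ A hA⟩
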